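/- **Setting.** Let $V=[n]$ and let $E$ be a set of $m$ nonempty subsets of $V$ (hyperedges) containing all singletons $\{1\},\dots,\{n\}$. Each $i\in V$ has a strict linear order $\succ_i$ on $\delta(i)=\{e\in E: i\in e\}$ in which $\{i\}$ is the worst element. For $i\in V$ the block $S_i$ consists of the $e\in E\setminus\{\{i\}\}$ with $\max e=i$. List $E$ as $e_1,\dots,e_m$ with $e_i=\{i\}$ for $i\in[n]$, followed by $S_1,\dots,S_n$ in this order, each $S_i$ listed in decreasing $\succ_i$-preference. Assume that $(V,E)$ is an arborescence hypergraph with depth-first principal tree. That is, there is an arborescence $\mathcal T$ on $U=\{v_1,\dots,v_{n+1}\}$ with root $v_{n+1}$ and arcs $f_1,\dots,f_n$ such that the head of $f_i$ is $v_i$, and $i\ge j$ whenever the directed path of $\mathcal T$ from the root to $v_j$ passes through $v_i$. There are arcs $a_1,\dots,a_m$ on $U$ such that the node-hyperedge incidence matrix of $(V,E)$ is the network matrix of $(a_1,\dots,a_m)$ with respect to $\mathcal T$: for $a_j=(u,v)$, the $(i,j)$ entry is $1$, $-1$ or $0$ according to whether $f_i$ is forward on, backward on, or not on the path of $\mathcal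 T$ from $u$ to $v$. The ordinal matrix $C$ has entry $c_{i,j}=|\delta(i)|-\ell$ if $e_j$ is the $\ell$-th best element of $\delta(i)$; the entries $c_{i,j}$ with $i\notin e_j$ are at least $|\delta(i)|$ and strictly decrease from left to right. Add a row and a column with index $0$: to the incidence matrix, giving $A$, add a $1$ in position $(0,0)$ and zeros elsewhere; to $C$ add the row $(0,m,m-1,\dots,1)$ and below its first entry the column $(M,\dots,M)^T$, with $M$ larger than all entries of the original matrix. Let $b$ be the all-ones vector. A set $B$ of $n+1$ columns is a feasible cardinal basis if $A_B$ is nonsingular and the unique $x$ supported on $B$ with $Ax=b$ is nonnegative; $x$ is its extreme point. Put $\mathcal A_B=\{a_j: j\in B,\ j\ne 0\}$ and $\mathcal T_B=(U,\mathcal A_B)$, which is a directed tree. For a set $O$ of columns and a row $i$ let $u^O_i=\min_{j\in O}c_{i,j}$; a column $j\in O$ is $i$-disliked w.r.t. $O$ if $u^O_i=c_{i,j}$. *Iteration* $(B,O)\to(B',O)\to(B',O')$. - Cardinal pivot with the first-forward-arc-leaving (FFL) rule: let $j_t$ be the unique element of $O\setminus B$, $a_{j_t}=(v,v')$. Among the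 forward arcs on the path of $\mathcal T_B$ from $v$ to $v'$, let $a_{j_\ell}$ be the first one with $x$-value $0$ or, if there is none, the first forward arc. Put $B'=(B\setminus\{j_\ell\})\cup\{j_t\}$. - Ordinal pivot with leaving column $j_\ell$, the unique element of $O\setminus B'$: let $i_\ell$ be the row such that $j_\ell$ is $i_\ell$-disliked w.r.t. $O$, let $j_r\in O\setminus\{j_\ell\}$ be the column with $c_{i_\ell,j_r}=u^{O\setminus\{j_\ell\}}_{i_\ell}$, and let $i_r$ be the row such that $j_r$ is $i_r$-disliked w.r.t. $O$. Let $j^*$ maximize $c_{i_r,k}$ over all $k\notin O$ with $c_{i,k}>u^{O\setminus\{j_\ell\}}_i$ for all $i\ne i_r$. Put $O'=(O\setminus\{j_\ell\})\cup\{j^*\}$. The algorithm starts with $B_0=\{0,\dots,n\}$, $O_0=\{1,\dots,n+1\}$ (where $m>n$) and repeats iterations until $B=O$. A *Scarf pair* is a pair $(B,O)$ with $B\neq O$ that occurs at the beginning or at the end of an iteration. Its *separator* is the $i\in[n]$ such that the hyperedge of the $0$-disliked column w.r.t. $O$ lies in $S_i$. For $i\in[n]$, a feasible cardinal basis $B$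 with extreme point $x$ is *$i$-nice* if - for every $v\ne v_{n+1}$, the path of $\mathcal T_B$ from $v_{n+1}$ to $v$ is $x$-augmenting, that is, $x$ is $1$ on its forward arcs and $0$ on its backward arcs; - $\{f_i,\dots,f_n\}\subseteq\mathcal A_B$; - for every $k\in\{i,\dots,n\}$, the only arc of $\mathcal A_B$ joining the two components of $\mathcal T$ without $f_k$ is $f_k$ itself. **Lemma.** Let $(B,O)$ be a Scarf pair with separator $i$, let $(B,O)\to(B',O)\to(B',O')$ be an iteration, and let $j_t$ be the unique element of $O\setminus B$, $j_\ell$ that of $B\setminus B'$, and $j^*$ that of $O'\setminus O$. Suppose that $B$ is $i$-nice and $j^*\ne 0$. Then: 1. If $a_{j_t}=(v_j,v_k)$, then $f_i=(v_j,v_i)$, and $f_i$ is the first arc on the path of $\mathcal T$ from $v_j$ to $v_k$. 2. $a_{j_\ell}=f_i$. 3. $(B',O')$ is a Scarf pair, and its separator is some $i'>i$. 4. $B'$ is $i'$-nice. -/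

import Mathlib

noncomputable section

namespace Scarf

/-! ### Cardinal bases -/

section Cardinal

variable {ι κ : Type*} [Fintype ι] [Fintype κ]

/-- `B` is a cardinal basis of `A`: as many columns as `A` has rows, and the (square) submatrix
`A_B` is nonsingular. -/
def IsCardinalBasis (A : Matrix ι κ ℝ) (B : Finset κ) : Prop :=
  B.card = Fintype.card ι ∧ LinearIndependent ℝ (fun j : B => fun i : ι => A i j)

/-- `B` is a feasible cardinal basis of `{x ≥ 0 : A x = b}`, and `x` is the extreme point
corresponding to it. -/
def IsExtremePointOf (A : Matrix ι κ ℝ) (b : ι → ℝ) (B : Finset κ) (x : κ → ℝ) : Prop :=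
  IsCardinalBasis A B ∧ A.mulVec x = b ∧ (∀ j, j ∉ B → x j = 0) ∧ ∀ j, 0 ≤ x j

end Cardinal

/-! ### Ordinal bases and ordinal pivots -/

section Ordinal

variable {ι κ : Type*}

/-- The utility `u_i^O`, the minimum of row `i` of `C` over the columns in `O` (`O` nonempty). -/
def utility (C : Matrix ι κ ℝ) (O : Finset κ) (i : ι) : ℝ :=
  sInf ((fun j => C i j) '' (O : Set κ))

/-- The column `j` is `i`-disliked with respect to `O`. -/
def IsDisliked (C : Matrix ι κ ℝ) (O : Finset κ) (i : ι) (j : κ) : Prop :=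
  j ∈ O ∧ utility C O i = C i j

/-- The set `K` of candidates for the entering column of an ordinal pivot from `O` with leaving
column `jl` and reference row `ir`. -/
def ordinalCandidates [DecidableEq κ] (C : Matrix ι κ ℝ) (O : Finset κ) (jl : κ) (ir : ι) : Set κ :=
  {k | k ∉ O ∧ ∀ i, i ≠ ir → utility C (O.erase jl) i < C i k}

/-- `O'` is obtained from `O` by the ordinal pivot with leaving column `jl`. Here `il` is the row
that dislikes `jl`, `jr` is the reference column, `ir` is the reference row, and `js` is the
entering column. -/
def IsOrdinalPivot [DecidableEq κ] (C : Matrix ι κ ℝ) (O : Finset κ) (jl : κ) (O' : Finset κ) :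
    Prop :=
  ∃ (il : ι) (jr : κ) (ir : ι) (js : κ),
    IsDisliked C O il jl ∧
    IsDisliked C (O.erase jl) il jr ∧
    IsDisliked C O ir jr ∧
    js ∈ ordinalCandidates C O jl ir ∧
    (∀ k ∈ ordinalCandidates C O jl ir, C ir k ≤ C ir js) ∧
    O' = insert js (O.erase jl)

end Ordinal

/-! ### Directed graphs: the arcs are labelled by a type `α`, and the arc with label `a` has tail
`(arc a).1` and head `(arc a).2`. A set `S` of labels selects the arcs of a directed graph. -/

section Digraph

variable {U α : Type*}

/-- The vertex at which one arrives after traversing an arc, in forward direction (`true`, from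
tail to head) or in backward direction (`false`, from head to tail). -/
def stepDst (arc : α → U × U) (s : α × Bool) : U :=
  if s.2 then (arc s.1).2 else (arc s.1).1

/-- The vertex at which a traversal of an arc starts. -/
def stepSrc (arc : α → U × U) (s : α × Bool) : U :=
  if s.2 then (arc s.1).1 else (arc s.1).2

/-- The sequence of arc traversals is an undirected walk from the first to the second vertex. -/
def IsWalk (arc : α → U × U) (S : Set α) : U → List (α × Bool) → U → Prop
  | u, [], w => u = w
  | u, s :: p, w => s.1 ∈ S ∧ stepSrc arc s = u ∧ IsWalk arc S (stepDst arc s) p w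

/-- The list of vertices that a walk starting in `u` visits. -/
def visited (arc : α → U × U) (u : U) (p : List (α × Bool)) : List U :=
  u :: p.map (stepDst arc)

/-- `p` is an (undirected) path from `u` to `w` in the directed graph with arc set `S`; the arcs
traversed with flag `true` are the forward arcs on `p`, the others are the backward arcs. -/
def IsPath (arc : α → U × U) (S : Set α) (u : U) (p : List (α × Bool)) (w : U) : Prop :=
  IsWalk arc S u p w ∧ (visited arc u p).Nodup

/-- `p` is a directed path from `u` to `w`. -/
def IsDirectedPath (arc : α → U × U) (S : Set α) (u : U) (p : List (α × Bool)) (w : U) : Prop :=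
  IsPath arc S u p w ∧ ∀ s ∈ p, s.2 = true

/-- The underlying undirected graph. -/
def underlying (arc : α → U × U) (S : Set α) : SimpleGraph U :=
  SimpleGraph.fromRel (fun u v => ∃ a ∈ S, arc a = (u, v))

/-- A directed tree: dropping the orientation of all arcs gives a tree (no loops, no parallel
edges, connected, acyclic). -/
def IsDirectedTree (arc : α → U × U) (S : Set α) : Prop :=
  (∀ a ∈ S, (arc a).1 ≠ (arc a).2) ∧
  Set.InjOn (fun a => s((arc a).1, (arc a).2)) S ∧
  (underlying arc S).IsTree

/-- An arborescence with root `r`. -/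
def IsArborescence (arc : α → U × U) (S : Set α) (r : U) : Prop :=
  IsDirectedTree arc S ∧ ∀ v, ∃ p, IsDirectedPath arc S r p v

/-- The order of an arborescence: the directed path from the root `r` to `w` passes through `v`. -/
def TreeGE (arc : α → U × U) (S : Set α) (r v w : U) : Prop :=
  ∃ p, IsDirectedPath arc S r p w ∧ v ∈ visited arc r p

/-- `M` is the network matrix of the directed graph with arcs `arc`, with principal tree given by
the arcs `f`. -/
def IsNetworkMatrix {β : Type*} (f : β → U × U) (arc : α → U × U) (M : Matrix β α ℝ) : Prop :=
  ∀ a, ∃ p, IsPath f Set.univ (arc a).1 p (arc a).2 ∧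
    ∀ i, ((i, true) ∈ p → M i a = 1) ∧ ((i, false) ∈ p → M i a = -1) ∧
      ((i, true) ∉ p → (i, false) ∉ p → M i a = 0)

end Digraph

/-- The arborescence with vertices `v_1, …, v_{n+1}` (indexed from `0` by `Fin (n + 1)`) and arcs
`f_1, …, f_n` (indexed from `0` by `Fin n`) is depth-first, with root `v_{n+1}`. -/
def IsDepthFirst {n : ℕ} (f : Fin n → Fin (n + 1) × Fin (n + 1)) : Prop :=
  IsArborescence f Set.univ (Fin.last n) ∧
  (∀ v w, TreeGE f Set.univ (Fin.last n) v w → w ≤ v) ∧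
  ∀ i : Fin n, (f i).2 = i.castSucc

/-! ### Hypergraphic preference systems and block-partitioned matrices -/

/-- A hypergraphic preference system on the nodes `1, …, n` (indexed from `0` by `Fin n`).
`pref i e e'` means `e ≻_i e'`; it matters only for hyperedges containing `i`. -/
structure PreferenceSystem (n : ℕ) where
  E : Finset (Finset (Fin n))
  pref : Fin n → Finset (Fin n) → Finset (Fin n) → Prop
  nonempty : ∀ e ∈ E, e.Nonempty
  singleton_mem : ∀ i, {i} ∈ E
  irrefl : ∀ i, ∀ e ∈ E, i ∈ e → ¬ pref i e e
  trans : ∀ i, ∀ e₁ ∈ E, ∀ e₂ ∈ E, ∀ e₃ ∈ E, i ∈ e₁ → i ∈ e₂ → i ∈ e₃ →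
    pref i e₁ e₂ → pref i e₂ e₃ → pref i e₁ e₃
  total : ∀ i, ∀ e₁ ∈ E, ∀ e₂ ∈ E, i ∈ e₁ → i ∈ e₂ → e₁ ≠ e₂ → pref i e₁ e₂ ∨ pref i e₂ e₁
  singleton_worst : ∀ i, ∀ e ∈ E, i ∈ e → e ≠ {i} → pref i e {i}

/-- `δ(i)`, the set of hyperedges containing `i`. -/
def PreferenceSystem.star {n : ℕ} (P : PreferenceSystem n) (i : Fin n) : Finset (Finset (Fin n)) :=
  P.E.filter (fun e => i ∈ e)

open Classical in
/-- The position of `e` in the list of the hyperedges in `δ(i)`, best one first, counted from `1`. -/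
def PreferenceSystem.rank {n : ℕ} (P : PreferenceSystem n) (i : Fin n) (e : Finset (Fin n)) : ℕ :=
  ((P.star i).filter (fun e' => P.pref i e' e)).card + 1

/-- The hyperedge `e` belongs to the `i`-th block: its largest node is `i`, and it is not `{i}`. -/
def InBlock {n : ℕ} (i : Fin n) (e : Finset (Fin n)) : Prop :=
  e ≠ {i} ∧ IsGreatest (e : Set (Fin n)) i

/-- `e` enumerates the hyperedges in the order of the block partition: first the singletons, then
the blocks one after another, each from the best to the worst hyperedge. -/
def IsBlockOrder {n m : ℕ} (P : PreferenceSystem n) (e : Fin m → Finset (Fin n)) : Prop :=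
  Function.Injective e ∧ Set.range e = (P.E : Set (Finset (Fin n))) ∧
  (∀ (i : Fin n) (j : Fin m), (j : ℕ) = (i : ℕ) → e j = {i}) ∧
  (∀ (i i' : Fin n) (j k : Fin m), InBlock i (e j) → InBlock i' (e k) → i < i' → j < k) ∧
  (∀ (i : Fin n) (j k : Fin m), InBlock i (e j) → InBlock i (e k) → P.pref i (e j) (e k) → j < k)

/-- The node-hyperedge incidence matrix. -/
def incidence {n m : ℕ} (e : Fin m → Finset (Fin n)) : Matrix (Fin n) (Fin m) ℝ :=
  fun i j => if i ∈ e j then 1 else 0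

/-- `C` is an ordinal matrix of the block-partitioned pair `(A, C)`: in row `i`, the entry of the
`ℓ`-th best hyperedge of `δ(i)` is `|δ(i)| - ℓ`, the other entries are at least `|δ(i)|` and
decrease from left to right. -/
def IsBlockOrdinal {n m : ℕ} (P : PreferenceSystem n) (e : Fin m → Finset (Fin n))
    (C : Matrix (Fin n) (Fin m) ℝ) : Prop :=
  (∀ i j, i ∈ e j → C i j = ((P.star i).card : ℝ) - (P.rank i (e j) : ℝ)) ∧
  (∀ i j, i ∉ e j → ((P.star i).card : ℝ) ≤ C i j) ∧
  (∀ i j k, i ∉ e j → i ∉ e k → j < k → C i k < C i j)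

/-- `A` with an additional row and column `0`. -/
def augmentA {n m : ℕ} (A : Matrix (Fin n) (Fin m) ℝ) : Matrix (Fin (n + 1)) (Fin (m + 1)) ℝ :=
  Fin.cons (Fin.cons 1 (fun _ => 0)) (fun i => Fin.cons 0 (A i))

/-- `C` with an additional row `(0, m, m - 1, …, 1)` and an additional column `(0, M, …, M)`. -/
def augmentC {n m : ℕ} (C : Matrix (Fin n) (Fin m) ℝ) (M : ℝ) :
    Matrix (Fin (n + 1)) (Fin (m + 1)) ℝ :=
  Fin.cons (Fin.cons 0 (fun j => (m : ℝ) - (j : ℕ))) (fun i => Fin.cons M (C i))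

/-! ### Scarf's algorithm on an arborescence hypergraphic preference system -/

/-- The input: a hypergraphic preference system on the nodes `1, …, n`, with `m` hyperedges listed
by `e` in the order of the block partition, whose hypergraph is an arborescence hypergraph with
depth-first principal tree `f` (the node `i` is the arc `f i`) and arcs `arc j` for the hyperedges
`e j`; the ordinal matrix `C` of the block partition; and a number `M` larger than all its
entries. Row `i` of `A`, `C` becomes row `i.succ` of the matrices augmented by a row and column `0`,
and column `j` becomes column `j.succ`. -/
structure Instance (n m : ℕ) where
  P : PreferenceSystem n
  e : Fin m → Finset (Fin n)
  f : Fin n → Fin (n + 1) × Fin (n + 1)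
  arc : Fin m → Fin (n + 1) × Fin (n + 1)
  C : Matrix (Fin n) (Fin m) ℝ
  M : ℝ
  blockOrder : IsBlockOrder P e
  depthFirst : IsDepthFirst f
  network : IsNetworkMatrix f arc (incidence e)
  blockOrdinal : IsBlockOrdinal P e C
  lt_M : ∀ i j, C i j < M

namespace Instance

variable {n m : ℕ} (I : Instance n m)

/-- The augmented incidence matrix. -/
def matA : Matrix (Fin (n + 1)) (Fin (m + 1)) ℝ := augmentA (incidence I.e)

/-- The augmented ordinal matrix. -/
def matC : Matrix (Fin (n + 1)) (Fin (m + 1)) ℝ := augmentC I.C I.M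

/-- `B` is a feasible cardinal basis with corresponding extreme point `x`; the right-hand side is
the all-ones vector. -/
def IsVertex (B : Finset (Fin (m + 1))) (x : Fin (m + 1) → ℝ) : Prop :=
  IsExtremePointOf I.matA (fun _ => 1) B x

/-- The arc set `𝒜_B` (as a set of labels) of the directed tree `𝒯_B`. The column `0` has no arc. -/
def basisArcs (B : Finset (Fin (m + 1))) : Set (Fin m) := {j | j.succ ∈ B}

/-- The path `p` is `x`-augmenting. -/
def IsAugmenting (x : Fin (m + 1) → ℝ) (p : List (Fin m × Bool)) : Prop :=
  ∀ s ∈ p, x s.1.succ = if s.2 then 1 else 0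

/-- The first forward arc leaving rule on the path `p`: the leaving arc `l` is the first forward arc
with value `0` if there is one, and otherwise the first forward arc. -/
def IsFirstForward (x : Fin (m + 1) → ℝ) (p : List (Fin m × Bool)) (l : Fin m) : Prop :=
  ∃ p₁ p₂, p = p₁ ++ (l, true) :: p₂ ∧
    ((x l.succ = 0 ∧ ∀ a, (a, true) ∈ p₁ → x a.succ ≠ 0) ∨
     ((∀ a, (a, true) ∈ p → x a.succ ≠ 0) ∧ ∀ a, (a, true) ∉ p₁))

/-- The cardinal pivot, under the first forward arc leaving rule, from the feasible cardinal basis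
`B` with entering column `jt`: `p` is the `𝒯_B`-path from the tail to the head of the entering
arc. -/
def IsCardinalPivot (B : Finset (Fin (m + 1))) (jt : Fin (m + 1)) (B' : Finset (Fin (m + 1))) :
    Prop :=
  jt ∉ B ∧ ∃ (x : Fin (m + 1) → ℝ) (t l : Fin m) (p : List (Fin m × Bool)),
    I.IsVertex B x ∧ jt = t.succ ∧
    IsPath I.arc (basisArcs B) (I.arc t).1 p (I.arc t).2 ∧
    IsFirstForward x p l ∧
    B' = insert jt (B.erase l.succ)

/-- An iteration `(B, O) → (B', O) → (B', O')`: a cardinal pivot whose entering column is the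
unique element of `O \ B`, then an ordinal pivot whose leaving column is the unique element of
`O \ B'`. -/
def IsIteration (B O B' O' : Finset (Fin (m + 1))) : Prop :=
  (∃ jt, O \ B = {jt} ∧ I.IsCardinalPivot B jt B') ∧
  ∃ jl, O \ B' = {jl} ∧ IsOrdinalPivot I.matC O jl O'

/-- The pairs `(B_k, O_k)` that the algorithm visits, starting with `B_0 = {0, …, n}` and
`O_0 = {1, …, n + 1}` (this needs `n + 1 ≤ m`), and stopping when `B_k = O_k`. -/
inductive Visits (I : Instance n m) : Finset (Fin (m + 1)) → Finset (Fin (m + 1)) → Prop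
  | init : n < m → Visits I (Finset.univ.filter (fun j => (j : ℕ) ≤ n))
      (Finset.univ.filter (fun j => 1 ≤ (j : ℕ) ∧ (j : ℕ) ≤ n + 1))
  | step {B O B' O' : Finset (Fin (m + 1))} :
      Visits I B O → B ≠ O → I.IsIteration B O B' O' → Visits I B' O'

/-- `(B, O)` is a Scarf pair. -/
def IsScarfPair (B O : Finset (Fin (m + 1))) : Prop := I.Visits B O ∧ B ≠ O

/-- `(B, O)` is a Scarf pair with separator `i`: the `0`-disliked column lies in the `i`-th block. -/
def IsSeparator (B O : Finset (Fin (m + 1))) (i : Fin n) : Prop :=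
  I.IsScarfPair B O ∧ ∃ j : Fin m, IsDisliked I.matC O 0 j.succ ∧ InBlock i (I.e j)

/-- The vertex `v` lies in the component containing the root of the principal tree without the arc
`f k`. -/
def OnRootSide (k : Fin n) (v : Fin (n + 1)) : Prop :=
  (underlying I.f {k}ᶜ).Reachable (Fin.last n) v

/-- `B` is an `i`-nice basis. -/
def IsNice (i : Fin n) (B : Finset (Fin (m + 1))) : Prop :=
  ∃ x, I.IsVertex B x ∧
    (∀ v, v ≠ Fin.last n →
      ∃ p, IsPath I.arc (basisArcs B) (Fin.last n) p v ∧ IsAugmenting x p) ∧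
    (∀ k, i ≤ k → ∃ j ∈ basisArcs B, I.arc j = I.f k) ∧
    (∀ k, i ≤ k → ∀ j ∈ basisArcs B,
      ¬ (I.OnRootSide k (I.arc j).1 ↔ I.OnRootSide k (I.arc j).2) → I.arc j = I.f k)

end Instance

end Scarf

end

/-! Let `anc f v` be the set of principal arcs between the root and `v`. By telescoping, the column
of an arc is the indicator of `anc` at its head minus that at its tail (`incidence_eq`), so crossing
the cut of `f i` means containing `i`. Niceness thus says that the singleton column `c` with arc `f
i` is the only column of `B` meeting row `i`. The column disliked by row 0 contains `i` and is not a
singleton, so it is the entering column `t`.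

Cardinal side: since `i` is the largest node of `t`, the arc of `t` starts in the tail of `f i` and
ends beyond `f i` (`arc_fst_eq`). The basis path between its ends begins with `c` and never returns
to the root side, so it prolongs the root path to its start without overlap. Hence it is augmenting,
no forward arc on it has value 0, and the rule selects `c`. The pivot exchanges 0 and 1 along this
path, and the new root paths are augmenting again. Identities between paths come from the linear
independence of basis columns instead of uniqueness of paths in trees.

Ordinal side: ordinal pivots preserve domination (`IsOrdinalPivot.isDominating`), which matches rows
with disliked columns. Row `i` dislikes the leaving singleton `c`, the reference column is `t`, and
the reference row is 0. By domination the entering column lies to the right of `t`; in the block of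
`i` it would be worse than `t` for `i`, so it lies in a later block. -/

noncomputable section

namespace Scarf

/-! ### Walks and paths -/

section Walks

variable {U α : Type*} {arc : α → U × U} {S S' : Set α} {u v w : U} {p q : List (α × Bool)}

theorem IsWalk.append (hp : IsWalk arc S u p v) (hq : IsWalk arc S v q w) :
    IsWalk arc S u (p ++ q) w := by
  induction p generalizing u with
  | nil => cases hp; exact hq
  | cons s p ih => exact ⟨hp.1, hp.2.1, ih hp.2.2⟩

theorem IsWalk.mem (hp : IsWalk arc S u p w) {s : α × Bool} (hs : s ∈ p) : s.1 ∈ S := by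
  induction p generalizing u with
  | nil => simp at hs
  | cons t p ih =>
    rcases List.mem_cons.1 hs with rfl | hs
    · exact hp.1
    · exact ih hp.2.2 hs

theorem IsWalk.mono (hp : IsWalk arc S u p w) (h : ∀ s ∈ p, s.1 ∈ S') :
    IsWalk arc S' u p w := by
  induction p generalizing u with
  | nil => exact hp
  | cons t p ih =>
    exact ⟨h t (by simp), hp.2.1, ih hp.2.2 fun s hs => h s (by simp [hs])⟩

theorem stepDst_not (arc : α → U × U) (a : α) (b : Bool) :
    stepDst arc (a, !b) = stepSrc arc (a, b) := by
  cases b <;> rfl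

theorem stepSrc_not (arc : α → U × U) (a : α) (b : Bool) :
    stepSrc arc (a, !b) = stepDst arc (a, b) := by
  cases b <;> rfl

theorem IsWalk.exists_reverse (hp : IsWalk arc S u p w) : ∃ q, IsWalk arc S w q u := by
  induction p generalizing u with
  | nil => exact ⟨[], hp.symm⟩
  | cons s p ih =>
    obtain ⟨q, hq⟩ := ih hp.2.2
    refine ⟨q ++ [(s.1, !s.2)], hq.append ⟨hp.1, ?_, ?_⟩⟩
    · exact stepSrc_not arc s.1 s.2
    · exact (stepDst_not arc s.1 s.2).trans hp.2.1

theorem stepDst_mem_visited {s : α × Bool} (hs : s ∈ p) : stepDst arc s ∈ visited arc u p :=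
  List.mem_cons_of_mem _ (List.mem_map_of_mem hs)

theorem IsWalk.stepSrc_mem_visited (hp : IsWalk arc S u p w) {s : α × Bool} (hs : s ∈ p) :
    stepSrc arc s ∈ visited arc u p := by
  induction p generalizing u with
  | nil => simp at hs
  | cons t p ih =>
    rcases List.mem_cons.1 hs with rfl | hs
    · rw [hp.2.1]; exact List.mem_cons_self
    · exact List.mem_cons_of_mem _ (ih hp.2.2 hs)

theorem IsPath.of_cons {s : α × Bool} (hp : IsPath arc S u (s :: p) w) :
    IsPath arc S (stepDst arc s) p w :=
  ⟨hp.1.2.2, (List.nodup_cons.1 hp.2).2⟩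

theorem IsPath.exists_of_mem_visited (hp : IsPath arc S u p w) (hv : v ∈ visited arc u p) :
    ∃ q, IsPath arc S v q w := by
  induction p generalizing u with
  | nil =>
    obtain rfl : v = u := by simpa [visited] using hv
    exact ⟨[], hp⟩
  | cons s p ih =>
    rcases List.mem_cons.1 hv with rfl | hv
    · exact ⟨_, hp⟩
    · exact ih hp.of_cons hv

theorem IsWalk.exists_isPath (hp : IsWalk arc S u p w) : ∃ q, IsPath arc S u q w := by
  induction p generalizing u with
  | nil => exact ⟨[], hp, by simp [visited]⟩
  | cons s p ih =>
    obtain ⟨q, hq⟩ := ih hp.2.2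
    by_cases hu : u ∈ visited arc (stepDst arc s) q
    · exact hq.exists_of_mem_visited hu
    · exact ⟨s :: q, ⟨hp.1, hp.2.1, hq.1⟩, List.nodup_cons.2 ⟨hu, hq.2⟩⟩

/-- If the first arc were traversed again, the rest of the path would visit both of its ends, hence
the start vertex a second time. -/
theorem IsPath.nodup_labels (hp : IsPath arc S u p w) : (p.map Prod.fst).Nodup := by
  induction p generalizing u with
  | nil => simp
  | cons s p ih =>
    refine List.nodup_cons.2 ⟨fun hs => ?_, ih hp.of_cons⟩
    obtain ⟨⟨a, b⟩, hsp, rfl⟩ := List.mem_map.1 hs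
    refine (List.nodup_cons.1 hp.2).1 ?_
    have h1 := hp.1.2.1
    have h2 := hp.of_cons.1.stepSrc_mem_visited hsp
    have h3 := stepDst_mem_visited (arc := arc) (u := stepDst arc s) hsp
    rcases s with ⟨a, b'⟩
    cases b <;> cases b' <;> simp_all [stepSrc, stepDst, visited]

/-- A step of a path that starts in the first vertex is the first step. -/
theorem IsPath.eq_cons_of_stepSrc_eq (hp : IsPath arc S u p w) {s : α × Bool} (hs : s ∈ p)
    (hu : stepSrc arc s = u) : ∃ q, p = s :: q := by
  cases p with
  | nil => simp at hs
  | cons t p =>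
    rcases List.mem_cons.1 hs with rfl | hs
    · exact ⟨p, rfl⟩
    · have := hp.of_cons.1.stepSrc_mem_visited hs
      rw [hu] at this
      exact absurd this (List.nodup_cons.1 hp.2).1

/-- If no arc of a walk crosses a cut, then the walk stays on the side where it starts. -/
theorem IsWalk.side (hp : IsWalk arc S u p w) {Q : U → Prop} (hu : Q u)
    (h : ∀ s ∈ p, (Q (arc s.1).1 ↔ Q (arc s.1).2)) : ∀ s ∈ p, Q (arc s.1).1 := by
  induction p generalizing u with
  | nil => simp
  | cons t p ih =>
    have ht := h t (by simp)
    have hsrc : Q (stepSrc arc t) := by rw [hp.2.1]; exact hu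
    have hQ : Q (arc t.1).1 ∧ Q (stepDst arc t) := by
      rcases t with ⟨a, b⟩
      cases b <;> simp_all [stepSrc, stepDst]
    intro s hs
    rcases List.mem_cons.1 hs with rfl | hs
    · exact hQ.1
    · exact ih hp.2.2 hQ.2 (fun s hs => h s (by simp [hs])) s hs

/-! ### Signed arc counts of walks -/

variable [DecidableEq α]

/-- The number of forward minus the number of backward traversals of each arc. -/
def signedCount : List (α × Bool) → α → ℝ
  | [] => 0
  | s :: p => Pi.single s.1 (if s.2 then 1 else -1) + signedCount p

theorem signedCount_eq_zero {a : α} (h : a ∉ p.map Prod.fst) : signedCount p a = 0 := by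
  induction p with
  | nil => rfl
  | cons s p ih =>
    simp only [List.map_cons, List.mem_cons, not_or] at h
    simp [signedCount, ih h.2, h.1]

theorem IsPath.signedCount_eq (hp : IsPath arc S u p w) {s : α × Bool} (hs : s ∈ p) :
    signedCount p s.1 = if s.2 then 1 else -1 := by
  induction p generalizing u with
  | nil => simp at hs
  | cons t p ih =>
    have hnd := List.nodup_cons.1 hp.nodup_labels
    rcases List.mem_cons.1 hs with rfl | hs
    · simp [signedCount, signedCount_eq_zero hnd.1]
    · have hne : s.1 ≠ t.1 := fun h => hnd.1 (h ▸ List.mem_map_of_mem hs)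
      simp [signedCount, ih hp.of_cons hs, hne]

theorem IsPath.signedCount_cases (hp : IsPath arc S u p w) (a : α) :
    (signedCount p a = 1 ∧ (a, true) ∈ p) ∨ (signedCount p a = -1 ∧ (a, false) ∈ p) ∨
      (signedCount p a = 0 ∧ a ∉ p.map Prod.fst) := by
  by_cases h : a ∈ p.map Prod.fst
  · obtain ⟨⟨a, b⟩, hs, rfl⟩ := List.mem_map.1 h
    have := hp.signedCount_eq hs
    cases b
    · exact Or.inr (Or.inl ⟨by simpa using this, hs⟩)
    · exact Or.inl ⟨by simpa using this, hs⟩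
  · exact Or.inr (Or.inr ⟨signedCount_eq_zero h, h⟩)

/-- The potential differences telescope along the walk. With `φ` the indicator of `k ∈ anc f v`,
this links walks to rows of the network matrix. -/
theorem IsWalk.sum_signedCount_mul [Fintype α] (hp : IsWalk arc S u p w) (φ : U → ℝ) :
    ∑ a, signedCount p a * (φ (arc a).2 - φ (arc a).1) = φ w - φ u := by
  induction p generalizing u with
  | nil => cases hp; simp [signedCount]
  | cons s p ih =>
    have h1 := hp.2.1
    simp only [signedCount, Pi.add_apply, add_mul, Finset.sum_add_distrib, ih hp.2.2]
    rw [Finset.sum_eq_single s.1 (fun a _ ha => by simp [ha]) (by simp)]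
    rcases s with ⟨a, b⟩
    cases b <;> simp [stepSrc, stepDst] at h1 ⊢ <;> rw [← h1]

end Walks

/-! ### Depth-first arborescences -/

section DepthFirst

variable {n : ℕ} {f : Fin n → Fin (n + 1) × Fin (n + 1)}

/-- The directed path from the root to `v_k` must enter `v_k` by `f k`, so it visits the tail of `f
k`; the order then bounds the tail below, and loops are excluded. -/
theorem IsDepthFirst.lt_tail (hf : IsDepthFirst f) (k : Fin n) : k.castSucc < (f k).1 := by
  obtain ⟨⟨htree, hdir⟩, hord, hhead⟩ := hf
  obtain ⟨p, hp, hfwd⟩ := hdir k.castSucc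
  have key : ∀ (q : List (Fin n × Bool)) (u w : Fin (n + 1)), IsWalk f Set.univ u q w → u ≠ w →
      (∀ s ∈ q, s.2 = true) → ∃ s ∈ q, s.2 = true ∧ (f s.1).2 = w := by
    intro q
    induction q with
    | nil => intro u w h hne; exact absurd h hne
    | cons s q ih =>
      intro u w h hne hq
      by_cases hw : stepDst f s = w
      · have := hq s (by simp)
        exact ⟨s, by simp, this, by simpa [stepDst, this] using hw⟩
      · obtain ⟨t, ht, h2⟩ := ih _ _ h.2.2 hw fun t ht => hq t (by simp [ht])
        exact ⟨t, by simp [ht], h2⟩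
  obtain ⟨s, hs, hs2, hsk⟩ := key p _ _ hp.1 (Fin.castSucc_lt_last k).ne' hfwd
  rw [hhead, Fin.castSucc_inj] at hsk
  have hsrc := hp.1.stepSrc_mem_visited hs
  simp only [stepSrc, hs2, hsk, if_true] at hsrc
  refine lt_of_le_of_ne (hord _ _ ⟨p, ⟨hp, hfwd⟩, hsrc⟩) ?_
  rw [← hhead k]
  exact (htree.1 k (Set.mem_univ _)).symm

theorem IsDepthFirst.induction (hf : IsDepthFirst f) {Q : Fin (n + 1) → Prop}
    (last : Q (Fin.last n)) (step : ∀ k, Q (f k).1 → Q k.castSucc) (v : Fin (n + 1)) : Q v := by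
  induction h : n - (v : ℕ) using Nat.strong_induction_on generalizing v with
  | _ d ih =>
    subst h
    induction v using Fin.lastCases with
    | last => exact last
    | cast k =>
      have h1 := hf.lt_tail k
      have h2 : (k.castSucc : ℕ) < (f k).1 := h1
      simp only [Fin.val_castSucc] at h2 ih
      exact step k (ih _ (by omega) _ rfl)

/-- The arcs on the path from the root to `v`, provided that `f` is depth-first. -/
def anc (f : Fin n → Fin (n + 1) × Fin (n + 1)) (v : Fin (n + 1)) : Finset (Fin n) :=
  if h : v = Fin.last n then ∅
  -- The comparison serves termination only; by `lt_tail` it always holds for depth-first `f`.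
  else if v < (f (v.castPred h)).1 then insert (v.castPred h) (anc f (f (v.castPred h)).1) else ∅
termination_by n - (v : ℕ)
decreasing_by
  have := (f (v.castPred h)).1.isLt
  omega

@[simp] theorem anc_last : anc f (Fin.last n) = ∅ := by
  rw [anc]; simp

theorem IsDepthFirst.anc_castSucc (hf : IsDepthFirst f) (k : Fin n) :
    anc f k.castSucc = insert k (anc f (f k).1) := by
  rw [anc, dif_neg (Fin.castSucc_lt_last k).ne]
  simp [hf.lt_tail k]

theorem IsDepthFirst.le_of_mem_anc (hf : IsDepthFirst f) {v : Fin (n + 1)} {l : Fin n}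
    (h : l ∈ anc f v) : v ≤ l.castSucc := by
  induction v using hf.induction with
  | last => simp at h
  | step k ih =>
    rw [hf.anc_castSucc, Finset.mem_insert] at h
    rcases h with rfl | h
    · exact le_rfl
    · exact (hf.lt_tail k).le.trans (ih h)

theorem IsDepthFirst.mem_anc_castSucc (hf : IsDepthFirst f) (k : Fin n) :
    k ∈ anc f k.castSucc := by
  simp [hf.anc_castSucc]

theorem IsDepthFirst.notMem_anc_tail (hf : IsDepthFirst f) (k : Fin n) : k ∉ anc f (f k).1 :=
  fun h => (hf.lt_tail k).not_ge (hf.le_of_mem_anc h)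

/-- Labels decrease along a path away from the root, so the initial part of the root path that ends
with `f k` consists of its labels at least `k`. -/
theorem IsDepthFirst.mem_anc_castSucc_iff (hf : IsDepthFirst f) {v : Fin (n + 1)} {k : Fin n}
    (h : k ∈ anc f v) (l : Fin n) : l ∈ anc f k.castSucc ↔ l ∈ anc f v ∧ k ≤ l := by
  induction v using hf.induction with
  | last => simp at h
  | step k' ih =>
    by_cases hk : k = k'
    · subst hk
      exact ⟨fun hl => ⟨hl, hf.le_of_mem_anc hl⟩, fun hl => hl.1⟩
    · have hlt : k' < k := lt_of_le_of_ne (hf.le_of_mem_anc h) (Ne.symm hk)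
      rw [hf.anc_castSucc k', Finset.mem_insert] at h
      rw [ih (h.resolve_left hk), hf.anc_castSucc k', Finset.mem_insert]
      refine ⟨fun hl => ⟨Or.inr hl.1, hl.2⟩, fun hl => ⟨hl.1.resolve_left ?_, hl.2⟩⟩
      rintro rfl
      exact hlt.not_ge hl.2

/-- A vertex other than the root is recovered from the smallest label in its set. -/
theorem IsDepthFirst.anc_injective (hf : IsDepthFirst f) : Function.Injective (anc f) := by
  intro v w h
  have key : ∀ v w, anc f v = anc f w → w ≤ v := by
    intro v w h
    induction v using Fin.lastCases with
    | last => exact Fin.le_last w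
    | cast k => exact hf.le_of_mem_anc (h ▸ hf.mem_anc_castSucc k)
  exact le_antisymm (key w v h.symm) (key v w h)

theorem IsDepthFirst.mem_anc_head_iff (hf : IsDepthFirst f) (a k : Fin n) :
    k ∈ anc f (f a).2 ↔ k = a ∨ k ∈ anc f (f a).1 := by
  rw [hf.2.2, hf.anc_castSucc, Finset.mem_insert]

/-- Only the arc `f k` changes membership of `k` in `anc`; conversely, the root path of `v` avoids
`f k`. -/
theorem IsDepthFirst.reachable_compl_iff (hf : IsDepthFirst f) (k : Fin n) (v : Fin (n + 1)) :
    (underlying f {k}ᶜ).Reachable (Fin.last n) v ↔ k ∉ anc f v := by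
  constructor
  · rintro ⟨p⟩ hk
    have key : ∀ {u w : Fin (n + 1)} (_ : (underlying f {k}ᶜ).Walk u w),
        k ∈ anc f w → k ∈ anc f u := by
      intro u w p
      induction p with
      | nil => exact id
      | @cons u v w h _ ih =>
        intro hw
        have hv := ih hw
        have hadj := (SimpleGraph.fromRel_adj _ _ _).1 h
        rcases hadj.2 with ⟨a, ha, hav⟩ | ⟨a, ha, hav⟩ <;>
          have h2 := hf.mem_anc_head_iff a k <;> rw [hav] at h2
        · exact (h2.1 hv).resolve_left fun h => ha h.symm
        · exact h2.2 (Or.inr hv)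
    simpa using key p hk
  · intro hk
    induction v using hf.induction with
    | last => exact SimpleGraph.Reachable.refl _
    | step a ih =>
      rw [hf.anc_castSucc, Finset.mem_insert, not_or] at hk
      refine (ih hk.2).trans (SimpleGraph.Adj.reachable ?_)
      refine (SimpleGraph.fromRel_adj _ _ _).2 ⟨(hf.lt_tail a).ne', Or.inl ⟨a, Ne.symm hk.1, ?_⟩⟩
      rw [← hf.2.2 a]

end DepthFirst

/-! ### Ordinal bases -/

section Ordinal

variable {ι κ : Type*} {C : Matrix ι κ ℝ} {O : Finset κ}

theorem utility_le {j : κ} (hj : j ∈ O) (i : ι) : utility C O i ≤ C i j :=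
  csInf_le ((O.finite_toSet.image _).bddBelow) ⟨j, hj, rfl⟩

theorem exists_isDisliked (hO : O.Nonempty) (i : ι) : ∃ j, IsDisliked C O i j := by
  have hne : ((fun j => C i j) '' (O : Set κ)).Nonempty := Set.Nonempty.image _ hO
  obtain ⟨j, hj, h⟩ := hne.csInf_mem (O.finite_toSet.image _)
  exact ⟨j, hj, h.symm⟩

theorem isDisliked_of_forall_le {i : ι} {j : κ} (hj : j ∈ O) (h : ∀ k ∈ O, C i j ≤ C i k) :
    IsDisliked C O i j := by
  obtain ⟨k, hk, hu⟩ := exists_isDisliked (C := C) ⟨j, hj⟩ i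
  exact ⟨hj, le_antisymm (utility_le hj i) (hu ▸ h k hk)⟩

theorem IsDisliked.le {i : ι} {j k : κ} (h : IsDisliked C O i j) (hk : k ∈ O) : C i j ≤ C i k :=
  h.2 ▸ utility_le hk i

theorem IsDisliked.unique {i : ι} {j k : κ} (hC : Function.Injective (C i))
    (hj : IsDisliked C O i j) (hk : IsDisliked C O i k) : j = k :=
  hC (hj.2.symm.trans hk.2)

theorem utility_anti {O' : Finset κ} (h : O' ⊆ O) (hne : O'.Nonempty) (i : ι) :
    utility C O i ≤ utility C O' i := by
  obtain ⟨j, hj, hu⟩ := exists_isDisliked (C := C) hne i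
  exact hu ▸ utility_le (h hj) i

theorem le_utility {i : ι} {r : ℝ} (hne : O.Nonempty) (h : ∀ j ∈ O, r ≤ C i j) :
    r ≤ utility C O i := by
  obtain ⟨j, hj, hu⟩ := exists_isDisliked (C := C) hne i
  exact hu ▸ h j hj

/-- No column exceeds the utilities of `O` in all rows. -/
def IsDominating (C : Matrix ι κ ℝ) (O : Finset κ) : Prop :=
  ∀ k, ∃ i, C i k ≤ utility C O i

theorem IsDominating.exists_row (h : IsDominating C O) {k : κ} (hk : k ∈ O) :
    ∃ i, IsDisliked C O i k := by
  obtain ⟨i, hi⟩ := h k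
  exact ⟨i, hk, le_antisymm (utility_le hk i) hi⟩

/-- By domination, sending each row to its disliked column maps onto `O`; equal cardinalities make
this map a bijection. -/
theorem IsDominating.row_unique [Fintype ι] (h : IsDominating C O)
    (hC : ∀ i, Function.Injective (C i)) (hcard : O.card = Fintype.card ι) {k : κ} {i i' : ι}
    (hi : IsDisliked C O i k) (hi' : IsDisliked C O i' k) : i = i' := by
  choose g hg using fun i => exists_isDisliked (C := C) ⟨k, hi.1⟩ i
  let g' : ι → O := fun i => ⟨g i, (hg i).1⟩
  have hsurj : Function.Surjective g' := by
    rintro ⟨j, hj⟩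
    obtain ⟨r, hr⟩ := h.exists_row hj
    exact ⟨r, Subtype.ext ((hg r).unique (hC r) hr)⟩
  have hinj : Function.Injective g' :=
    ((Fintype.bijective_iff_surjective_and_card g').2 ⟨hsurj, by simp [hcard]⟩).1
  exact hinj (Subtype.ext (((hg i).unique (hC i) hi).trans (hi'.unique (hC i') (hg i'))))

variable [DecidableEq κ] {O' : Finset κ} {jl : κ}

theorem IsOrdinalPivot.card_eq (h : IsOrdinalPivot C O jl O') : O'.card = O.card := by
  obtain ⟨il, jr, ir, js, h1, -, -, h4, -, rfl⟩ := h
  rw [Finset.card_insert_of_notMem (fun h => h4.1 (Finset.mem_of_mem_erase h)),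
    Finset.card_erase_add_one h1.1]

/-- Outside row `ir` no utility falls below that of `O.erase jl`. An old column stays blocked by the
row that dislikes it, except `jr`, which is now blocked by row `il`. A new column exceeding all
utilities would be a candidate, and the maximality of `js` blocks it in row `ir`. -/
theorem IsOrdinalPivot.isDominating (h : IsOrdinalPivot C O jl O') (hO : IsDominating C O)
    (hC : ∀ i, Function.Injective (C i)) : IsDominating C O' := by
  obtain ⟨il, jr, ir, js, hl, hr, hir, hjs, hmax, rfl⟩ := h
  have hne : (O.erase jl).Nonempty := ⟨jr, hr.1⟩
  have hsub : O.erase jl ⊆ O := Finset.erase_subset _ _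
  have hrow : il ≠ ir := by
    rintro rfl
    exact Finset.ne_of_mem_erase hr.1 (hir.unique (hC _) hl)
  have hother : ∀ i, i ≠ ir →
      utility C (O.erase jl) i ≤ utility C (insert js (O.erase jl)) i := by
    intro i hi
    refine le_utility (Finset.insert_nonempty _ _) fun j hj => ?_
    rcases Finset.mem_insert.1 hj with rfl | hj
    · exact (hjs.2 i hi).le
    · exact utility_le hj i
  intro k
  by_contra! hk
  by_cases hkO : k ∈ O
  · by_cases hkl : k = jl
    · subst hkl
      have := hk il
      have h1 := hother il hrow
      have h2 : utility C O il ≤ _ := utility_anti hsub hne il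
      rw [hl.2] at h2
      linarith
    · obtain ⟨i, hi⟩ := hO.exists_row hkO
      by_cases hii : i = ir
      · subst hii
        obtain rfl := hi.unique (hC _) hir
        have h1 := hother il hrow
        rw [hr.2] at h1
        exact (hk il).not_ge h1
      · have h1 := hother i hii
        have h2 : utility C O i ≤ _ := utility_anti hsub hne i
        rw [hi.2] at h2
        linarith [hk i]
  · have hcand : k ∈ ordinalCandidates C O jl ir :=
      ⟨hkO, fun i hi => (hother i hi).trans_lt (hk i)⟩
    have hle := hmax k hcand
    obtain ⟨i, hi⟩ := hO k
    have h2 : utility C O i ≤ _ := utility_anti hsub hne i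
    by_cases hii : i = ir
    · subst hii
      obtain ⟨j, hj, hu⟩ := exists_isDisliked (C := C) (Finset.insert_nonempty js (O.erase jl)) i
      have hki := hk i
      rw [hu] at hki
      rcases Finset.mem_insert.1 hj with rfl | hj
      · linarith
      · have := utility_le (C := C) hj i
        linarith
    · linarith [hother i hii, hk i]

end Ordinal

/-! ### Ranks in the preference lists -/

namespace PreferenceSystem

variable {n : ℕ} (P : PreferenceSystem n)

theorem mem_star {i : Fin n} {e : Finset (Fin n)} : e ∈ P.star i ↔ e ∈ P.E ∧ i ∈ e := by
  simp [star]

theorem rank_lt_of_pref {i : Fin n} {e e' : Finset (Fin n)} (he : e ∈ P.star i)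
    (he' : e' ∈ P.star i) (h : P.pref i e e') : P.rank i e < P.rank i e' := by
  classical
  rw [mem_star] at he he'
  unfold rank
  refine Nat.add_lt_add_right (Finset.card_lt_card ((Finset.ssubset_iff_of_subset ?_).2
    ⟨e, ?_, ?_⟩)) 1
  · intro a ha
    simp only [Finset.mem_filter, mem_star] at ha ⊢
    exact ⟨ha.1, P.trans i a ha.1.1 e he.1 e' he'.1 ha.1.2 he.2 he'.2 ha.2 h⟩
  · simpa [mem_star, he] using h
  · simpa using fun _ => P.irrefl i e he.1 he.2

theorem one_le_rank (i : Fin n) (e : Finset (Fin n)) : 1 ≤ P.rank i e :=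
  Nat.le_add_left _ _

end PreferenceSystem

namespace Instance

variable {n m : ℕ} (I : Instance n m)

/-! ### The hyperedges and their order -/

theorem e_mem (j : Fin m) : I.e j ∈ I.P.E := by
  have : I.e j ∈ Set.range I.e := ⟨j, rfl⟩
  rwa [I.blockOrder.2.1] at this

theorem e_mem_star {i : Fin n} {j : Fin m} (h : i ∈ I.e j) : I.e j ∈ I.P.star i :=
  I.P.mem_star.2 ⟨I.e_mem j, h⟩

theorem val_eq_of_singleton {i : Fin n} {j : Fin m} (h : I.e j = {i}) : (j : ℕ) = i := by
  -- An instance does not assume this inequality; it holds because the `n` distinct singletons are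
  -- among the `m` hyperedges.
  have hn : n ≤ m := by
    have h1 : Fintype.card (Fin n) ≤ Fintype.card (Fin m) := by
      have hex : ∀ i : Fin n, ∃ j, I.e j = {i} := fun i => by
        have : ({i} : Finset (Fin n)) ∈ (I.P.E : Set (Finset (Fin n))) := I.P.singleton_mem i
        rwa [← I.blockOrder.2.1] at this
      choose g hg using hex
      refine Fintype.card_le_of_injective g fun a b hab => ?_
      have := (hg a).symm.trans ((congrArg I.e hab).trans (hg b))
      exact Finset.singleton_injective this
    simpa using h1
  have h1 := I.blockOrder.2.2.1 i (i.castLE hn) rfl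
  rw [I.blockOrder.1 (h.trans h1.symm)]
  rfl

theorem e_eq_singleton {i : Fin n} {j : Fin m} (h : (j : ℕ) = i) : I.e j = {i} :=
  I.blockOrder.2.2.1 i j h

theorem exists_inBlock {j : Fin m} (h : n ≤ j) : ∃ i, InBlock i (I.e j) := by
  have hne := I.P.nonempty _ (I.e_mem j)
  refine ⟨(I.e j).max' hne, fun hs => ?_, (I.e j).isGreatest_max' hne⟩
  have := I.val_eq_of_singleton hs
  omega

theorem le_of_inBlock {j : Fin m} {i : Fin n} (h : InBlock i (I.e j)) : n ≤ j := by
  by_contra! hj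
  have h1 := I.e_eq_singleton (i := ⟨j, hj⟩) (j := j) rfl
  have h2 := h.2.1
  rw [h1] at h2
  obtain rfl : i = ⟨j, hj⟩ := by simpa using h2
  exact h.1 h1

/-! ### The ordinal matrix -/

theorem C_lt_of_pref {i : Fin n} {j k : Fin m} (hj : i ∈ I.e j) (hk : i ∈ I.e k)
    (h : I.P.pref i (I.e j) (I.e k)) : I.C i k < I.C i j := by
  rw [I.blockOrdinal.1 i j hj, I.blockOrdinal.1 i k hk]
  have : (I.P.rank i (I.e j) : ℝ) < I.P.rank i (I.e k) := by
    exact_mod_cast I.P.rank_lt_of_pref (I.e_mem_star hj) (I.e_mem_star hk) h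
  linarith

theorem C_lt_of_mem_of_notMem {i : Fin n} {j k : Fin m} (hj : i ∈ I.e j) (hk : i ∉ I.e k) :
    I.C i j < I.C i k := by
  have h1 := I.blockOrdinal.2.1 i k hk
  rw [I.blockOrdinal.1 i j hj]
  have : (1 : ℝ) ≤ I.P.rank i (I.e j) := by exact_mod_cast I.P.one_le_rank i (I.e j)
  linarith

/-- Entries of hyperedges containing `i` are separated by preference, the others by position, and
the former lie below the latter. This makes disliked columns unique. -/
theorem C_injective (i : Fin n) : Function.Injective (I.C i) := by
  intro j k h
  by_contra hne
  by_cases hj : i ∈ I.e j <;> by_cases hk : i ∈ I.e k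
  · rcases I.P.total i _ (I.e_mem j) _ (I.e_mem k) hj hk (fun h => hne (I.blockOrder.1 h)) with
      h' | h'
    · exact (I.C_lt_of_pref hj hk h').ne h.symm
    · exact (I.C_lt_of_pref hk hj h').ne h
  · exact (I.C_lt_of_mem_of_notMem hj hk).ne h
  · exact (I.C_lt_of_mem_of_notMem hk hj).ne h.symm
  · rcases lt_or_gt_of_ne hne with h' | h'
    · exact (I.blockOrdinal.2.2 i j k hj hk h').ne h.symm
    · exact (I.blockOrdinal.2.2 i k j hk hj h').ne h

theorem C_singleton_le {i : Fin n} {j : Fin m} (hj : I.e j = {i}) (k : Fin m) :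
    I.C i j ≤ I.C i k := by
  have hij : i ∈ I.e j := by simp [hj]
  by_cases hk : i ∈ I.e k
  · by_cases hkj : I.e k = {i}
    · rw [I.blockOrder.1 (hj.trans hkj.symm)]
    · refine (I.C_lt_of_pref hk hij ?_).le
      rw [hj]
      exact I.P.singleton_worst i _ (I.e_mem k) hk hkj
  · exact (I.C_lt_of_mem_of_notMem hij hk).le

@[simp] theorem matC_zero_succ (j : Fin m) : I.matC 0 j.succ = (m : ℝ) - (j : ℕ) := rfl

theorem matC_zero_pos (j : Fin m) : 0 < I.matC 0 j.succ := by
  have : ((j : ℕ) : ℝ) < m := by exact_mod_cast j.isLt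
  simpa only [matC_zero_succ, sub_pos] using this

theorem matC_zero_le_iff (j k : Fin m) : I.matC 0 j.succ ≤ I.matC 0 k.succ ↔ k ≤ j := by
  rw [matC_zero_succ, matC_zero_succ, sub_le_sub_iff_left, Nat.cast_le, Fin.le_def]

theorem matC_injective (i : Fin (n + 1)) : Function.Injective (I.matC i) := by
  intro j k h
  cases i using Fin.cases with
  | zero =>
    cases j using Fin.cases with
    | zero =>
      cases k using Fin.cases with
      | zero => rfl
      | succ k => exact absurd h (I.matC_zero_pos k).ne
    | succ j =>
      cases k using Fin.cases with
      | zero => exact absurd h (I.matC_zero_pos j).ne'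
      | succ k =>
        rw [le_antisymm ((I.matC_zero_le_iff k j).1 h.ge) ((I.matC_zero_le_iff j k).1 h.le)]
  | succ i =>
    cases j using Fin.cases with
    | zero =>
      cases k using Fin.cases with
      | zero => rfl
      | succ k => exact absurd h (I.lt_M i k).ne'
    | succ j =>
      cases k using Fin.cases with
      | zero => exact absurd h (I.lt_M i j).ne
      | succ k => exact congrArg Fin.succ (I.C_injective i h)

theorem matC_singleton_le {i : Fin n} {j : Fin m} (hj : I.e j = {i}) (k : Fin (m + 1)) :
    I.matC i.succ j.succ ≤ I.matC i.succ k := by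
  cases k using Fin.cases with
  | zero => exact (I.lt_M i j).le
  | succ k => exact I.C_singleton_le hj k

/-- The ordinal bases that the algorithm visits. -/
theorem Visits.isDominating {B O : Finset (Fin (m + 1))} (h : I.Visits B O) :
    O.card = n + 1 ∧ IsDominating I.matC O := by
  induction h with
  | init hnm =>
    constructor
    · have : (Finset.univ.filter (fun j : Fin (m + 1) => 1 ≤ (j : ℕ) ∧ (j : ℕ) ≤ n + 1)) =
          Finset.Icc ⟨1, by omega⟩ ⟨n + 1, by omega⟩ := by
        ext j
        simp [Fin.le_def]
      rw [this, Fin.card_Icc]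
      simp
    -- Row 0 blocks column 0 and, since its later entries decrease, every column from the last one
    -- of `O_0` on; each singleton is blocked by its own row.
    · intro k
      cases k using Fin.cases with
      | zero =>
        refine ⟨0, le_utility ⟨⟨1, by omega⟩, by simp⟩ fun j _ => ?_⟩
        cases j using Fin.cases with
        | zero => exact le_rfl
        | succ j => exact (I.matC_zero_pos j).le
      | succ k =>
        by_cases hk : (k : ℕ) < n
        · exact ⟨Fin.succ ⟨k, hk⟩, le_utility ⟨⟨1, by omega⟩, by simp⟩ fun j _ =>
            I.matC_singleton_le (I.e_eq_singleton rfl) j⟩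
        · refine ⟨0, le_utility ⟨⟨1, by omega⟩, by simp⟩ fun j hj => ?_⟩
          cases j using Fin.cases with
          | zero => simp at hj
          | succ j =>
            rw [matC_zero_le_iff, Fin.le_def]
            simp at hj
            omega
  | step _ _ hit ih =>
    obtain ⟨-, jl, -, hp⟩ := hit
    exact ⟨hp.card_eq.trans ih.1, hp.isDominating ih.2 I.matC_injective⟩

/-! ### The network matrix -/

/-- Telescoping along the principal path: `f i` alone changes the indicator of `i ∈ anc`, by 1. -/
theorem incidence_eq (i : Fin n) (a : Fin m) : incidence I.e i a =
    (if i ∈ anc I.f (I.arc a).2 then 1 else 0) - (if i ∈ anc I.f (I.arc a).1 then 1 else 0) := by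
  obtain ⟨p, hp, hM⟩ := I.network a
  have h1 := hp.1.sum_signedCount_mul (fun v => if i ∈ anc I.f v then (1 : ℝ) else 0)
  have h2 : ∀ k, ((if i ∈ anc I.f (I.f k).2 then (1 : ℝ) else 0) -
      if i ∈ anc I.f (I.f k).1 then 1 else 0) = if k = i then 1 else 0 := by
    intro k
    have h3 := I.depthFirst.notMem_anc_tail k
    have h4 := I.depthFirst.mem_anc_head_iff k i
    by_cases hk : k = i
    · subst hk
      simp [h4, h3]
    · have : ¬ i = k := fun h => hk h.symm
      simp [h4, this, hk]
  simp only [h2, mul_ite, mul_one, mul_zero, Finset.sum_ite_eq', Finset.mem_univ, if_true] at h1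
  rw [← h1]
  have hi := hM i
  rcases hp.signedCount_cases i with ⟨h, h'⟩ | ⟨h, h'⟩ | ⟨h, h'⟩
  · rw [h, hi.1 h']
  · rw [h, hi.2.1 h']
  · rw [h, hi.2.2 (fun h => h' (List.mem_map_of_mem h)) (fun h => h' (List.mem_map_of_mem h))]

theorem mem_e_iff (i : Fin n) (a : Fin m) :
    i ∈ I.e a ↔ i ∈ anc I.f (I.arc a).2 ∧ i ∉ anc I.f (I.arc a).1 := by
  have h := I.incidence_eq i a
  unfold incidence at h
  split_ifs at h <;> simp_all
  norm_num at h

/-- The entry -1 does not occur in an incidence matrix, so no hyperedge arc leads back to the root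
side of a cut. -/
theorem mem_anc_arc_snd {i : Fin n} {a : Fin m} (h : i ∈ anc I.f (I.arc a).1) :
    i ∈ anc I.f (I.arc a).2 := by
  have h' := I.incidence_eq i a
  unfold incidence at h'
  split_ifs at h' <;> simp_all
  norm_num at h'

theorem e_eq_of_arc_eq {a : Fin m} {k : Fin n} (h : I.arc a = I.f k) : I.e a = {k} := by
  ext i
  rw [mem_e_iff, h, I.depthFirst.mem_anc_head_iff, Finset.mem_singleton]
  have := I.depthFirst.notMem_anc_tail k
  constructor
  · rintro ⟨h1, h2⟩
    exact h1.resolve_right h2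
  · rintro rfl
    exact ⟨Or.inl rfl, this⟩

theorem crosses_iff (k : Fin n) (a : Fin m) :
    ¬ (I.OnRootSide k (I.arc a).1 ↔ I.OnRootSide k (I.arc a).2) ↔ k ∈ I.e a := by
  unfold OnRootSide
  rw [I.depthFirst.reachable_compl_iff, I.depthFirst.reachable_compl_iff, mem_e_iff]
  have := @I.mem_anc_arc_snd n m k a
  tauto

/-- An arc starts in the tail of the first arc on its path in the principal tree. -/
theorem arc_fst_eq {a : Fin m} {i : Fin n} (h : IsGreatest (I.e a : Set (Fin n)) i) :
    (I.arc a).1 = (I.f i).1 := by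
  have hD := I.depthFirst
  have hi := (I.mem_e_iff i a).1 h.1
  refine hD.anc_injective (Finset.ext fun l => ?_)
  -- The root path to the tail of `f i` consists of the labels above `i` on the root path to the
  -- head of `a`. By maximality of `i`, these labels are not in the hyperedge, so they also lie
  -- above the tail of `a`.
  have h1 : l ∈ anc I.f (I.f i).1 ↔ l ∈ anc I.f (I.arc a).2 ∧ i < l := by
    have h2 := hD.mem_anc_castSucc_iff hi.1 l
    rw [hD.anc_castSucc, Finset.mem_insert] at h2
    constructor
    · intro hl
      have h3 := h2.1 (Or.inr hl)
      refine ⟨h3.1, lt_of_le_of_ne h3.2 ?_⟩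
      rintro rfl
      exact hD.notMem_anc_tail _ hl
    · rintro ⟨hl, hlt⟩
      exact (h2.2 ⟨hl, hlt.le⟩).resolve_left hlt.ne'
  rw [h1]
  constructor
  · intro hl
    have hl2 := I.mem_anc_arc_snd hl
    refine ⟨hl2, lt_of_not_ge fun hle => hi.2 ?_⟩
    have h3 := (hD.mem_anc_castSucc_iff hl2 i).2 ⟨hi.1, hle⟩
    exact ((hD.mem_anc_castSucc_iff hl i).1 h3).1
  · rintro ⟨hl, hlt⟩
    by_contra hn
    exact hlt.not_ge (h.2 ((I.mem_e_iff l a).2 ⟨hl, hn⟩))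

/-- The path of an arc in the principal tree begins with the arc of its largest node. -/
theorem exists_isPath_head {a : Fin m} {i : Fin n} (h : IsGreatest (I.e a : Set (Fin n)) i) :
    ∃ p, IsPath I.f Set.univ (I.arc a).1 p (I.arc a).2 ∧ p.head? = some (i, true) := by
  obtain ⟨p, hp, hM⟩ := I.network a
  have h1 : incidence I.e i a = 1 := if_pos h.1
  have hmem : (i, true) ∈ p := by
    by_contra hn
    by_cases hf : (i, false) ∈ p
    · have := (hM i).2.1 hf
      norm_num [h1] at this
    · have := (hM i).2.2 hn hf
      norm_num [h1] at this
  obtain ⟨q, rfl⟩ := hp.eq_cons_of_stepSrc_eq hmem (I.arc_fst_eq h).symm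
  exact ⟨_, hp, rfl⟩

/-! ### Bases -/

variable {B : Finset (Fin (m + 1))} {x : Fin (m + 1) → ℝ}

/-- Passing to vectors on all columns that vanish off `B` makes independence applicable to path
vectors. -/
theorem isCardinalBasis_iff : IsCardinalBasis I.matA B ↔ B.card = n + 1 ∧
    ∀ y : Fin (m + 1) → ℝ, (∀ j, j ∉ B → y j = 0) → I.matA.mulVec y = 0 → y = 0 := by
  unfold IsCardinalBasis
  rw [Fintype.card_fin, Fintype.linearIndependent_iff]
  have hsum : ∀ y : Fin (m + 1) → ℝ, (∀ j, j ∉ B → y j = 0) →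
      ∑ j : B, y j • (fun i => I.matA i j) = I.matA.mulVec y := by
    intro y hy
    ext i
    rw [Finset.sum_apply]
    simp only [Pi.smul_apply, smul_eq_mul, Matrix.mulVec, dotProduct]
    rw [Finset.sum_coe_sort B (fun j => y j * I.matA i j)]
    rw [Finset.sum_subset (Finset.subset_univ B) fun j _ hj => by rw [hy j hj, zero_mul]]
    exact Finset.sum_congr rfl fun j _ => mul_comm _ _
  refine and_congr_right fun _ => ⟨fun h y hy h0 => ?_, fun h g hg j => ?_⟩
  · funext j
    by_cases hj : j ∈ B
    · exact h (fun j => y j) ((hsum y hy).trans h0) ⟨j, hj⟩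
    · exact hy j hj
  · let y : Fin (m + 1) → ℝ := fun j => if hj : j ∈ B then g ⟨j, hj⟩ else 0
    have hy : ∀ j, j ∉ B → y j = 0 := fun j hj => dif_neg hj
    have hyg : ∀ j : B, y j = g j := fun j => dif_pos j.2
    have := h y hy (by rw [← hsum y hy]; simpa only [hyg] using hg)
    rw [← hyg, this]
    rfl

@[simp] theorem mulVec_zero_row (y : Fin (m + 1) → ℝ) : I.matA.mulVec y 0 = y 0 := by
  simp [Matrix.mulVec, dotProduct, Fin.sum_univ_succ, matA, augmentA]

@[simp] theorem mulVec_succ_row (y : Fin (m + 1) → ℝ) (i : Fin n) :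
    I.matA.mulVec y i.succ = ∑ a, incidence I.e i a * y a.succ := by
  simp [Matrix.mulVec, dotProduct, Fin.sum_univ_succ, matA, augmentA]

/-- The vector of signed traversal numbers, with an additional entry `0` for the column `0`. -/
def pathVector (p : List (Fin m × Bool)) : Fin (m + 1) → ℝ := Fin.cons 0 (signedCount p)

@[simp] theorem pathVector_zero (p : List (Fin m × Bool)) : pathVector p 0 = 0 := rfl

@[simp] theorem pathVector_succ (p : List (Fin m × Bool)) (a : Fin m) :
    pathVector p a.succ = signedCount p a := rfl

/-- The characteristic vector of the path from the root to a vertex. -/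
def rootVector (v : Fin (n + 1)) : Fin (n + 1) → ℝ :=
  Fin.cons 0 (fun i => if i ∈ anc I.f v then 1 else 0)

theorem rootVector_succ (v : Fin (n + 1)) (i : Fin n) :
    I.rootVector v i.succ = if i ∈ anc I.f v then 1 else 0 := rfl

@[simp] theorem rootVector_last : I.rootVector (Fin.last n) = 0 := by
  ext i
  cases i using Fin.cases <;> simp [rootVector]

/-- The image depends on the ends only. With `eq_of_mulVec_eq`, this replaces uniqueness of paths in
the basis tree. -/
theorem mulVec_pathVector {S : Set (Fin m)} {u w : Fin (n + 1)} {p : List (Fin m × Bool)}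
    (hp : IsWalk I.arc S u p w) :
    I.matA.mulVec (pathVector p) = I.rootVector w - I.rootVector u := by
  ext i
  cases i using Fin.cases with
  | zero => simp [rootVector]
  | succ i =>
    have h := hp.sum_signedCount_mul (fun v => if i ∈ anc I.f v then (1 : ℝ) else 0)
    rw [mulVec_succ_row, Pi.sub_apply, rootVector_succ, rootVector_succ, ← h]
    exact Finset.sum_congr rfl fun a _ => by rw [incidence_eq, pathVector_succ, mul_comm]

theorem mulVec_single (t : Fin m) : I.matA.mulVec (Pi.single t.succ 1) =
    I.rootVector (I.arc t).2 - I.rootVector (I.arc t).1 := by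
  have h := I.mulVec_pathVector (S := Set.univ) (u := (I.arc t).1) (w := (I.arc t).2)
    (p := [(t, true)]) ⟨Set.mem_univ _, rfl, rfl⟩
  rw [← h]
  congr 1
  ext j
  cases j using Fin.cases with
  | zero => simp
  | succ j => simp [signedCount, Pi.single_apply]

theorem pathVector_support {u w : Fin (n + 1)} {p : List (Fin m × Bool)}
    (hp : IsWalk I.arc (basisArcs B) u p w) (j : Fin (m + 1)) (hj : j ∉ B) :
    pathVector p j = 0 := by
  cases j using Fin.cases with
  | zero => rfl
  | succ j =>
    rw [pathVector_succ]
    refine signedCount_eq_zero fun h => hj ?_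
    obtain ⟨s, hs, rfl⟩ := List.mem_map.1 h
    exact hp.mem hs

/-- Vectors supported on a cardinal basis with equal images are equal. -/
theorem eq_of_mulVec_eq (hB : IsCardinalBasis I.matA B) {y z : Fin (m + 1) → ℝ}
    (hy : ∀ j, j ∉ B → y j = 0) (hz : ∀ j, j ∉ B → z j = 0)
    (h : I.matA.mulVec y = I.matA.mulVec z) : y = z :=
  sub_eq_zero.1 (((I.isCardinalBasis_iff).1 hB).2 (y - z)
    (fun j hj => by simp [hy j hj, hz j hj]) (by rw [Matrix.mulVec_sub, h, sub_self]))

theorem IsVertex.unique {y : Fin (m + 1) → ℝ} (hx : I.IsVertex B x) (hy : I.IsVertex B y) :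
    x = y :=
  I.eq_of_mulVec_eq hx.1 hx.2.2.1 hy.2.2.1 (hx.2.1.trans hy.2.1.symm)

/-! ### The cardinal pivot from a nice basis -/

section CardinalPivot

variable {B : Finset (Fin (m + 1))} {x : Fin (m + 1) → ℝ} {i : Fin n} {c t : Fin m}
  {p : List (Fin m × Bool)}

theorem IsNice.exists_arc_eq (h : I.IsNice i B) {k : Fin n} (hk : i ≤ k) :
    ∃ c : Fin m, c.succ ∈ B ∧ I.arc c = I.f k := by
  obtain ⟨-, -, -, h, -⟩ := h
  exact h k hk

theorem IsNice.arc_eq_of_mem (h : I.IsNice i B) {k : Fin n} (hk : i ≤ k) {j : Fin m}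
    (hj : j.succ ∈ B) (hkj : k ∈ I.e j) : I.arc j = I.f k := by
  obtain ⟨-, -, -, -, h⟩ := h
  exact h k hk j hj ((I.crosses_iff k j).2 hkj)

theorem IsNice.exists_augmenting (h : I.IsNice i B) (hx : I.IsVertex B x) (v : Fin (n + 1)) :
    ∃ p, IsPath I.arc (basisArcs B) (Fin.last n) p v ∧ IsAugmenting x p := by
  obtain ⟨y, hy, h, -⟩ := h
  obtain rfl := hx.unique I hy
  by_cases hv : v = Fin.last n
  · subst hv
    exact ⟨[], ⟨rfl, by simp [visited]⟩, by simp [IsAugmenting]⟩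
  · exact h v hv

/-- If `c` is the only basis column that meets the row `i`, and it is the singleton `{i}`, then a
walk traverses it according to the sides of its ends. -/
theorem signedCount_eq_of_unique (hc : I.e c = {i})
    (huniq : ∀ j : Fin m, j.succ ∈ B → i ∈ I.e j → j = c) {u w : Fin (n + 1)}
    (hp : IsWalk I.arc (basisArcs B) u p w) :
    signedCount p c = (if i ∈ anc I.f w then 1 else 0) - (if i ∈ anc I.f u then 1 else 0) := by
  have h := congrFun (I.mulVec_pathVector hp) i.succ
  rw [Pi.sub_apply, rootVector_succ, rootVector_succ, mulVec_succ_row,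
    Finset.sum_eq_single c] at h
  · simpa [incidence, hc] using h
  · intro a _ ha
    by_cases hi : i ∈ I.e a
    · rw [I.pathVector_support hp a.succ fun haB => ha (huniq a haB hi), mul_zero]
    · simp [incidence, hi]
  · simp

theorem side_iff_of_notMem {a : Fin m} (h : i ∉ I.e a) :
    i ∈ anc I.f (I.arc a).1 ↔ i ∈ anc I.f (I.arc a).2 := by
  have h1 := I.mem_e_iff i a
  have h2 := @I.mem_anc_arc_snd n m i a
  tauto

/-- The situation of a cardinal pivot from an `i`-nice basis `B` with extreme point `x`: the column
`c` has the arc `f i`, the entering column `t` has the largest node `i`, and `p` is the path between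
the ends of the entering arc. -/
structure NicePivot (B : Finset (Fin (m + 1))) (x : Fin (m + 1) → ℝ) (i : Fin n) (c t : Fin m)
    (p : List (Fin m × Bool)) : Prop where
  isVertex : I.IsVertex B x
  mem : c.succ ∈ B
  arc_eq : I.arc c = I.f i
  unique : ∀ j : Fin m, j.succ ∈ B → i ∈ I.e j → j = c
  isGreatest : IsGreatest (I.e t : Set (Fin n)) i
  isPath : IsPath I.arc (basisArcs B) (I.arc t).1 p (I.arc t).2
  notMem : t.succ ∉ B
  augmenting : ∀ v, ∃ p, IsPath I.arc (basisArcs B) (Fin.last n) p v ∧ IsAugmenting x p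

variable {I}

/-- The ends of the path lie on different sides of the cut of `f i`, which only `c` crosses, so `c`
is traversed forward. It starts where the path starts, in the tail of `f i`. -/
theorem NicePivot.pivotPath_eq_cons (D : I.NicePivot B x i c t p) : ∃ q, p = (c, true) :: q := by
  have hi := (I.mem_e_iff i t).1 D.isGreatest.1
  have h1 := I.signedCount_eq_of_unique (I.e_eq_of_arc_eq D.arc_eq) D.unique D.isPath.1
  simp only [hi, if_true, if_false, sub_zero] at h1
  refine D.isPath.eq_cons_of_stepSrc_eq (s := (c, true)) ?_ ?_
  · rcases D.isPath.signedCount_cases c with h | h | h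
    · exact h.2
    · norm_num [h1] at h
    · norm_num [h1] at h
  · rw [I.arc_fst_eq D.isGreatest, ← D.arc_eq]
    rfl

/-- The path between the ends of the entering arc has no arc in common with a path from the root
to a vertex on the root side of `f i`. -/
theorem NicePivot.signedCount_rootPath_eq_zero (D : I.NicePivot B x i c t p)
    {p₁ : List (Fin m × Bool)} {v : Fin (n + 1)}
    (hp₁ : IsPath I.arc (basisArcs B) (Fin.last n) p₁ v) (hv : i ∉ anc I.f v) {a : Fin m} (ha : signedCount p a ≠ 0) : signedCount p₁ a = 0 := by
  have hec := I.e_eq_of_arc_eq D.arc_eq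
  have hc0 : signedCount p₁ c = 0 := by
    simpa [hv] using I.signedCount_eq_of_unique hec D.unique hp₁.1
  obtain ⟨q, rfl⟩ := D.pivotPath_eq_cons
  by_cases hac : a = c
  · rw [hac, hc0]
  have hnd := List.nodup_cons.1 D.isPath.nodup_labels
  have hside : ∀ (r : List (Fin m × Bool)) (u w : Fin (n + 1)),
      IsWalk I.arc (basisArcs B) u r w → c ∉ r.map Prod.fst → ∀ s ∈ r,
        (i ∈ anc I.f (I.arc s.1).1 ↔ i ∈ anc I.f (I.arc s.1).2) := by
    intro r u w hr hcr s hs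
    refine I.side_iff_of_notMem fun his => hcr ?_
    rw [← D.unique s.1 (hr.mem hs) his]
    exact List.mem_map_of_mem hs
  refine signedCount_eq_zero fun ha₁ => ?_
  have haq : a ∈ q.map Prod.fst := by
    by_contra h
    exact ha (signedCount_eq_zero (by simp only [List.map_cons, List.mem_cons]; tauto))
  obtain ⟨s, hs, rfl⟩ := List.mem_map.1 haq
  obtain ⟨s', hs', hss⟩ := List.mem_map.1 ha₁
  -- After its first step `c` the pivot path stays beyond `f i`, whereas the root path stays on the
  -- root side, so they cannot share an arc.
  have h1 : i ∈ anc I.f (I.arc s.1).1 := by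
    refine D.isPath.of_cons.1.side (Q := fun v => i ∈ anc I.f v) ?_
      (hside _ _ _ D.isPath.of_cons.1 hnd.1) s hs
    simp only [stepDst, if_true, D.arc_eq, I.depthFirst.mem_anc_head_iff, true_or]
  have h2 : i ∉ anc I.f (I.arc s'.1).1 := by
    refine hp₁.1.side (Q := fun v => i ∉ anc I.f v) (by simp) (fun s hs => not_congr ?_) s' hs'
    refine hside _ _ _ hp₁.1 (fun hc => ?_) s hs
    rcases hp₁.signedCount_cases c with h | h | h
    · norm_num [hc0] at h
    · norm_num [hc0] at h
    · exact h.2 hc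
  exact h2 (hss ▸ h1)

theorem eq_of_signedCount_augmenting {u w : Fin (n + 1)} {r : List (Fin m × Bool)}
    (hr : IsPath I.arc (basisArcs B) u r w) (hx : IsAugmenting x r) (a : Fin m) :
    (signedCount r a = 1 ∧ x a.succ = 1) ∨ (signedCount r a = -1 ∧ x a.succ = 0) ∨
      signedCount r a = 0 := by
  rcases hr.signedCount_cases a with h | h | h
  · exact Or.inl ⟨h.1, by simpa using hx _ h.2⟩
  · exact Or.inr (Or.inl ⟨h.1, by simpa using hx _ h.2⟩)
  · exact Or.inr (Or.inr h.1)

/-- The path between the ends of the entering arc is augmenting. -/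
theorem NicePivot.pivotPath_augmenting (D : I.NicePivot B x i c t p) (a : Fin m) :
    (signedCount p a = 1 ∧ x a.succ = 1) ∨ (signedCount p a = -1 ∧ x a.succ = 0) ∨
      signedCount p a = 0 := by
  by_cases ha : signedCount p a = 0
  · exact Or.inr (Or.inr ha)
  obtain ⟨p₁, hp₁, -⟩ := D.augmenting (I.arc t).1
  obtain ⟨p₂, hp₂, hx₂⟩ := D.augmenting (I.arc t).2
  have h0 := D.signedCount_rootPath_eq_zero hp₁ ((I.mem_e_iff i t).1 D.isGreatest.1).2 ha
  -- As vectors, the root path to the tail followed by `p` is the root path to the head. By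
  -- disjointness, `p` inherits its signs and values from the latter.
  have hsum : pathVector p₁ + pathVector p = pathVector p₂ := by
    refine I.eq_of_mulVec_eq D.isVertex.1 (fun j hj => ?_) (I.pathVector_support hp₂.1) ?_
    · simp [I.pathVector_support hp₁.1 j hj, I.pathVector_support D.isPath.1 j hj]
    · rw [Matrix.mulVec_add, I.mulVec_pathVector hp₁.1, I.mulVec_pathVector D.isPath.1,
        I.mulVec_pathVector hp₂.1]
      abel
  have h := congrFun hsum a.succ
  simp only [Pi.add_apply, pathVector_succ, h0, zero_add] at h
  rw [h]
  exact I.eq_of_signedCount_augmenting hp₂ hx₂ a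

/-- The leaving arc of the first forward arc leaving rule. -/
theorem NicePivot.leaving_eq (D : I.NicePivot B x i c t p) {l : Fin m}
    (hl : IsFirstForward x p l) : l = c := by
  obtain ⟨q, hq⟩ := D.pivotPath_eq_cons
  obtain ⟨p₁, p₂, hp12, h⟩ := hl
  -- A forward arc of value 0 is impossible on an augmenting path; otherwise the rule takes the
  -- first forward arc, which is `c`.
  rcases h with ⟨hx, -⟩ | ⟨-, h⟩
  · have h1 : signedCount p l = 1 := by
      simpa using D.isPath.signedCount_eq (s := (l, true)) (by simp [hp12])
    rcases D.pivotPath_augmenting l with h | h | h <;>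
      norm_num [h1, hx] at h
  · rw [hp12] at hq
    cases p₁ with
    | nil => simpa using congrArg Prod.fst (List.cons.inj hq).1
    | cons s p₁ =>
      obtain rfl := (List.cons.inj hq).1
      exact absurd (by simp) (h c)

/-- The extreme point after the cardinal pivot. -/
def pivotPoint (x : Fin (m + 1) → ℝ) (t : Fin m) (p : List (Fin m × Bool)) : Fin (m + 1) → ℝ :=
  x + Pi.single t.succ 1 - pathVector p

theorem NicePivot.mulVec_entering (D : I.NicePivot B x i c t p) :
    I.matA.mulVec (Pi.single t.succ 1 - pathVector p) = 0 := by
  rw [Matrix.mulVec_sub, I.mulVec_single, I.mulVec_pathVector D.isPath.1, sub_self]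

theorem NicePivot.signedCount_leaving (D : I.NicePivot B x i c t p) : signedCount p c = 1 := by
  obtain ⟨q, hq⟩ := D.pivotPath_eq_cons
  simpa using D.isPath.signedCount_eq (s := (c, true)) (by simp [hq])

/-- Subtracting from a kernel vector `y` its multiple of the exchange vector that clears the entry
`t` leaves a kernel vector supported on `B`, hence 0. The entry at `c` then forces `y t.succ = 0`.
-/
theorem NicePivot.isCardinalBasis_pivot (D : I.NicePivot B x i c t p) :
    IsCardinalBasis I.matA (insert t.succ (B.erase c.succ)) := by
  have hB' := I.isCardinalBasis_iff.1 D.isVertex.1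
  have hpc := D.signedCount_leaving
  have htc : c.succ ≠ t.succ := fun h => D.notMem (h ▸ D.mem)
  refine I.isCardinalBasis_iff.2 ⟨?_, fun y hy h0 => ?_⟩
  · rw [Finset.card_insert_of_notMem (fun h => D.notMem (Finset.mem_of_mem_erase h)),
      Finset.card_erase_add_one D.mem, hB'.1]
  · have hz : y = y t.succ • (Pi.single t.succ 1 - pathVector p) := by
      rw [← sub_eq_zero]
      refine hB'.2 _ (fun j hj => ?_) ?_
      · by_cases hjt : j = t.succ
        · subst hjt
          have htp := I.pathVector_support D.isPath.1 _ D.notMem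
          rw [pathVector_succ] at htp
          simp [htp]
        · have : y j = 0 := hy j fun h => by
            rcases Finset.mem_insert.1 h with h | h
            · exact hjt h
            · exact hj (Finset.mem_of_mem_erase h)
          simp [this, hjt, I.pathVector_support D.isPath.1 j hj]
      · rw [Matrix.mulVec_sub, h0, Matrix.mulVec_smul, D.mulVec_entering, smul_zero, sub_zero]
    have hyc : y c.succ = 0 := hy _ (by simp [htc])
    have h1 := congrFun hz c.succ
    have h2 : y t.succ = 0 := by simpa [hyc, hpc, htc] using h1
    rw [hz, h2, zero_smul]

/-- A step of length 1 lowers forward arcs from 1 to 0 and raises backward arcs from 0 to 1; in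
particular `c` drops to 0. -/
theorem NicePivot.isVertex_pivot (D : I.NicePivot B x i c t p) :
    I.IsVertex (insert t.succ (B.erase c.succ)) (pivotPoint x t p) := by
  have hpaug := D.pivotPath_augmenting
  have hpc := D.signedCount_leaving
  have htc : c.succ ≠ t.succ := fun h => D.notMem (h ▸ D.mem)
  refine ⟨D.isCardinalBasis_pivot, ?_, fun j hj => ?_, fun j => ?_⟩
  · rw [pivotPoint, add_sub_assoc, Matrix.mulVec_add, D.mulVec_entering, add_zero]
    exact D.isVertex.2.1
  · rw [Finset.mem_insert, Finset.mem_erase, not_or, not_and_or, not_not] at hj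
    obtain ⟨hjt, rfl | hjB⟩ := hj
    · have := hpaug c
      norm_num [hpc] at this
      simp [pivotPoint, this, hpc, hjt]
    · simp [pivotPoint, D.isVertex.2.2.1 j hjB, hjt, I.pathVector_support D.isPath.1 j hjB]
  · have h1 : (0 : ℝ) ≤ (Pi.single t.succ 1 : Fin (m + 1) → ℝ) j :=
      (Pi.single_nonneg.2 zero_le_one : (0 : Fin (m + 1) → ℝ) ≤ _) j
    have h2 := D.isVertex.2.2.2 j
    simp only [pivotPoint, Pi.add_apply, Pi.sub_apply]
    cases j using Fin.cases with
    | zero => rw [pathVector_zero]; linarith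
    | succ j =>
      rw [pathVector_succ]
      rcases hpaug j with h | h | h
      · rw [h.1, h.2]; linarith
      · rw [h.1, h.2]; linarith
      · rw [h]; linarith

/-- Each traversal of `c` is replaced by a detour along `t` and the rest of the pivot path. -/
theorem NicePivot.exists_path_pivot (D : I.NicePivot B x i c t p) (v : Fin (n + 1)) :
    ∃ q, IsPath I.arc (basisArcs (insert t.succ (B.erase c.succ))) (Fin.last n) q v := by
  set S' := basisArcs (insert t.succ (B.erase c.succ)) with hS'
  have hmem : ∀ a, a ∈ basisArcs B → a ≠ c → a ∈ S' := by
    intro a ha hac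
    exact Finset.mem_insert_of_mem (Finset.mem_erase.2 ⟨fun h => hac (Fin.succ_injective _ h), ha⟩)
  have htS : t ∈ S' := Finset.mem_insert_self _ _
  have hc : ∃ q, IsWalk I.arc S' (I.arc c).1 q (I.arc c).2 := by
    obtain ⟨q, rfl⟩ := D.pivotPath_eq_cons
    have hnd := List.nodup_cons.1 D.isPath.nodup_labels
    have hq : IsWalk I.arc S' (I.arc c).2 q (I.arc t).2 := D.isPath.of_cons.1.mono fun s hs =>
      hmem _ (D.isPath.of_cons.1.mem hs) fun h => hnd.1 (List.mem_map.2 ⟨s, hs, h⟩)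
    obtain ⟨r, hr⟩ := hq.exists_reverse
    exact ⟨(t, true) :: r, htS, D.isPath.1.2.1.symm, hr⟩
  have key : ∀ (q : List (Fin m × Bool)) (u w : Fin (n + 1)),
      IsWalk I.arc (basisArcs B) u q w → ∃ r, IsWalk I.arc S' u r w := by
    intro q
    induction q with
    | nil => exact fun u w h => ⟨[], h⟩
    | cons s q ih =>
      rintro u w ⟨hs, rfl, h⟩
      obtain ⟨r, hr⟩ := ih _ _ h
      by_cases hsc : s.1 = c
      · have : ∃ r', IsWalk I.arc S' (stepSrc I.arc s) r' (stepDst I.arc s) := by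
          rcases s with ⟨a, b⟩
          obtain rfl : a = c := hsc
          obtain ⟨q', hq'⟩ := hc
          cases b
          · exact hq'.exists_reverse
          · exact ⟨q', hq'⟩
        obtain ⟨r', hr'⟩ := this
        exact ⟨r' ++ r, hr'.append hr⟩
      · exact ⟨s :: r, hmem _ hs hsc, rfl, hr⟩
  obtain ⟨q, hq, -⟩ := D.augmenting v
  obtain ⟨r, hr⟩ := key q _ _ hq.1
  exact hr.exists_isPath

theorem NicePivot.exists_augmenting_pivot (D : I.NicePivot B x i c t p) (v : Fin (n + 1)) :
    ∃ q, IsPath I.arc (basisArcs (insert t.succ (B.erase c.succ))) (Fin.last n) q v ∧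
      IsAugmenting (pivotPoint x t p) q := by
  obtain ⟨q, hq⟩ := D.exists_path_pivot v
  refine ⟨q, hq, ?_⟩
  obtain ⟨r, hr, hxr⟩ := D.augmenting v
  have hpaug := D.pivotPath_augmenting
  have hraug := I.eq_of_signedCount_augmenting hr hxr
  have hpc := D.signedCount_leaving
  have hec := I.e_eq_of_arc_eq D.arc_eq
  have hrc : signedCount r c = if i ∈ anc I.f v then 1 else 0 := by
    simpa using I.signedCount_eq_of_unique hec D.unique hr.1
  have htc : c.succ ≠ t.succ := fun h => D.notMem (h ▸ D.mem)
  have hsupp : ∀ {u w : Fin (n + 1)} {r : List (Fin m × Bool)},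
      IsWalk I.arc (basisArcs B) u r w → signedCount r t = 0 := fun hr =>
    I.pathVector_support hr t.succ D.notMem
  -- The new root path is the old one with `c` exchanged for the detour exactly when `v` lies beyond
  -- `f i`.
  have hsum : pathVector q =
      pathVector r + signedCount r c • (Pi.single t.succ 1 - pathVector p) := by
    refine I.eq_of_mulVec_eq (D.isCardinalBasis_pivot)
      (I.pathVector_support hq.1) (fun j hj => ?_) ?_
    · rw [Finset.mem_insert, Finset.mem_erase, not_or, not_and_or, not_not] at hj
      obtain ⟨hjt, rfl | hjB⟩ := hj
      · simp [hpc, hjt]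
      · simp [hjt, I.pathVector_support D.isPath.1 j hjB, I.pathVector_support hr.1 j hjB]
    · rw [Matrix.mulVec_add, Matrix.mulVec_smul, D.mulVec_entering, smul_zero, add_zero,
        I.mulVec_pathVector hq.1, I.mulVec_pathVector hr.1]
  rintro ⟨a, b⟩ hs
  have h1 := hq.signedCount_eq hs
  have h2 := congrFun hsum a.succ
  by_cases hat : a = t
  · subst hat
    have hxt := D.isVertex.2.2.1 _ D.notMem
    simp [hsupp hr.1, hsupp D.isPath.1] at h2
    simp only [pivotPoint, Pi.add_apply, Pi.sub_apply, hxt, Pi.single_eq_same, pathVector_succ,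
      hsupp D.isPath.1]
    rw [h1, hrc] at h2
    cases b
    · exfalso
      simp only [Bool.false_eq_true, if_false] at h2
      split_ifs at h2 <;> norm_num at h2
    · simp
  · have hat' : a.succ ≠ t.succ := fun h => hat (Fin.succ_injective _ h)
    simp only [pathVector_succ, Pi.add_apply, Pi.smul_apply, Pi.sub_apply, smul_eq_mul,
      Pi.single_eq_of_ne hat', zero_sub, h1] at h2
    simp only [pivotPoint, Pi.add_apply, Pi.sub_apply, Pi.single_eq_of_ne hat', pathVector_succ,
      add_zero]
    -- Beyond `f i`, the path vector and the extreme point both change by minus the pivot path; on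
    -- the root side the old root path is kept and is disjoint from the pivot path.
    by_cases hv : i ∈ anc I.f v
    · rw [hrc, if_pos hv] at h2
      rcases hraug a with h3 | h3 | h3 <;> rcases hpaug a with h4 | h4 | h4 <;> cases b <;>
        simp only [h3, h4, if_true, if_false, Bool.false_eq_true] at h2 ⊢ <;>
        linarith
    · rw [hrc, if_neg hv, zero_mul, add_zero] at h2
      have hp0 : signedCount p a = 0 := by
        by_contra hne
        rw [D.signedCount_rootPath_eq_zero hr hv hne] at h2
        cases b <;> norm_num at h2
      rw [hp0, sub_zero]
      simpa using hxr (a, b) (by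
        rcases hr.signedCount_cases a with h3 | h3 | h3 <;> cases b <;> norm_num [h3.1] at h2
        · exact h3.2
        · exact h3.2)

end CardinalPivot

/-! ### The separator after an ordinal pivot -/

section Separator

variable {I : Instance n m} {B O : Finset (Fin (m + 1))} {x : Fin (m + 1) → ℝ} {i : Fin n}
  {c t : Fin m}
  {p : List (Fin m × Bool)}

/-- The pivoted basis is `i'`-nice for all `i' > i`. -/
theorem NicePivot.isNice (D : I.NicePivot B x i c t p) (hB : I.IsNice i B) {i' : Fin n}
    (hi : i < i') : I.IsNice i' (insert t.succ (B.erase c.succ)) := by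
  refine ⟨_, D.isVertex_pivot, fun v _ => D.exists_augmenting_pivot v, fun k hk => ?_,
    fun k hk j hj hcross => ?_⟩
  · obtain ⟨j, hj, hjk⟩ := hB.exists_arc_eq I (hi.le.trans hk)
    refine ⟨j, Finset.mem_insert_of_mem (Finset.mem_erase.2 ⟨fun h => ?_, hj⟩), hjk⟩
    have h1 := I.e_eq_of_arc_eq hjk
    rw [Fin.succ_injective _ h, I.e_eq_of_arc_eq D.arc_eq] at h1
    exact (hi.trans_le hk).ne (Finset.singleton_injective h1)
  · rw [crosses_iff] at hcross
    rcases Finset.mem_insert.1 hj with h | h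
    · rw [Fin.succ_injective _ h] at hcross
      exact absurd (D.isGreatest.2 hcross) (hi.trans_le hk).not_ge
    · exact hB.arc_eq_of_mem I (hi.le.trans hk) (Finset.mem_of_mem_erase h) hcross

/-- Row 0 of the system reads `x 0 = 1`. -/
theorem zero_mem_of_isVertex (hx : I.IsVertex B x) : 0 ∈ B := by
  by_contra h
  have h1 := congrFun hx.2.1 0
  rw [mulVec_zero_row, hx.2.2.1 0 h] at h1
  norm_num at h1

theorem zero_notMem_of_isDisliked (h : IsDisliked I.matC O 0 t.succ) : 0 ∉ O := fun h0 =>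
  (h.le h0).not_gt (I.matC_zero_pos t)

/-- The column that is `0`-disliked is the last one. -/
theorem isDisliked_zero_iff : IsDisliked I.matC O 0 t.succ ↔
    t.succ ∈ O ∧ 0 ∉ O ∧ ∀ j : Fin m, j.succ ∈ O → j ≤ t := by
  constructor
  · exact fun h => ⟨h.1, zero_notMem_of_isDisliked h, fun j hj =>
      (I.matC_zero_le_iff t j).1 (h.le hj)⟩
  · rintro ⟨ht, h0, h⟩
    refine isDisliked_of_forall_le ht fun k hk => ?_
    cases k using Fin.cases with
    | zero => exact absurd hk h0
    | succ k => exact (I.matC_zero_le_iff t k).2 (h k hk)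

/-- The separator increases in an ordinal pivot in which the singleton of the separator leaves,
and no other column but the last one meets it. -/
theorem exists_separator_of_isOrdinalPivot {O' : Finset (Fin (m + 1))} {s : Fin m}
    (hO : O.card = n + 1 ∧ IsDominating I.matC O) (hpiv : IsOrdinalPivot I.matC O c.succ O')
    (hs : O' \ O = {s.succ}) (hc : I.e c = {i}) (ht : IsDisliked I.matC O 0 t.succ)
    (hblock : InBlock i (I.e t))
    (hmeet : ∀ a : Fin m, a.succ ∈ O → i ∈ I.e a → a = c ∨ a = t) :
    ∃ i', i < i' ∧ InBlock i' (I.e s) ∧ IsDisliked I.matC O' 0 s.succ := by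
  obtain ⟨il, jr, ir, js, hl, hr, hir, hjs, -, rfl⟩ := hpiv
  have hcard : O.card = Fintype.card (Fin (n + 1)) := by simpa using hO.1
  have hct : c ≠ t := by
    rintro rfl
    exact hblock.1 hc
  obtain rfl : il = i.succ := hO.2.row_unique I.matC_injective hcard hl
    (isDisliked_of_forall_le hl.1 fun k _ => I.matC_singleton_le hc k)
  -- Once `c` is gone, `t` is the only column containing `i`, and all other entries of row `i` are
  -- larger.
  have htr : IsDisliked I.matC (O.erase c.succ) i.succ t.succ := by
    refine isDisliked_of_forall_le
      (Finset.mem_erase.2 ⟨fun h => hct (Fin.succ_injective _ h).symm, ht.1⟩) fun k hk => ?_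
    cases k using Fin.cases with
    | zero => exact (I.lt_M i t).le
    | succ a =>
      obtain ⟨hac, haO⟩ := Finset.mem_erase.1 hk
      by_cases hia : i ∈ I.e a
      · rcases hmeet a haO hia with rfl | rfl
        · exact absurd rfl hac
        · exact le_rfl
      · exact (I.C_lt_of_mem_of_notMem hblock.2.1 hia).le
  obtain rfl := hr.unique (I.matC_injective _) htr
  obtain rfl : ir = 0 := hO.2.row_unique I.matC_injective hcard hir ht
  obtain rfl : js = s.succ := by
    have : js ∈ insert js (O.erase c.succ) \ O :=
      Finset.mem_sdiff.2 ⟨Finset.mem_insert_self _ _, hjs.1⟩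
    rw [hs] at this
    exact Finset.mem_singleton.1 this
  -- The entering column exceeds the utilities in all rows but 0, so domination of `O` must act in
  -- row 0, whose entries decrease from column 1 on.
  have hts : t < s := by
    by_contra! hst
    obtain ⟨r, hr⟩ := hO.2 s.succ
    by_cases h0 : r = 0
    · subst h0
      rw [ht.2, matC_zero_le_iff] at hr
      exact hjs.1 (le_antisymm hst hr ▸ ht.1)
    · exact (hjs.2 r h0).not_ge
        (hr.trans (utility_anti (Finset.erase_subset _ _) ⟨_, htr.1⟩ r))
  obtain ⟨i', hi'⟩ := I.exists_inBlock ((I.le_of_inBlock hblock).trans hts.le)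
  refine ⟨i', ?_, hi', ?_⟩
  · rcases lt_trichotomy i i' with h | rfl | h
    · exact h
    -- Within one block the later column `s` is worse for `i` than `t`, contradicting that its entry
    -- exceeds the utility in row `i`, attained at `t`.
    · exfalso
      rcases I.P.total i _ (I.e_mem t) _ (I.e_mem s) hblock.2.1 hi'.2.1
        (fun h => hts.ne (I.blockOrder.1 h)) with h | h
      · have h1 := hjs.2 i.succ (Fin.succ_ne_zero i)
        rw [htr.2] at h1
        exact (I.C_lt_of_pref hblock.2.1 hi'.2.1 h).not_gt h1
      · exact (I.blockOrder.2.2.2.2 i s t hi' hblock h).not_gt hts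
    · exact absurd (I.blockOrder.2.2.2.1 _ _ s t hi' hblock h) hts.not_gt
  · have h1 := isDisliked_zero_iff.1 ht
    refine isDisliked_zero_iff.2 ⟨Finset.mem_insert_self _ _, fun h => ?_, fun j hj => ?_⟩
    · rcases Finset.mem_insert.1 h with h | h
      · exact Fin.succ_ne_zero _ h.symm
      · exact h1.2.1 (Finset.mem_of_mem_erase h)
    · rcases Finset.mem_insert.1 hj with h | h
      · exact (Fin.succ_injective _ h).le
      · exact (h1.2.2 j (Finset.mem_of_mem_erase h)).trans hts.le

end Separator

end Instance

end Scarf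

end

/-! ### The two pivots combined into an iteration -/

theorem mainTheorem2 {n m : ℕ} (I : Scarf.Instance n m)
    (B O B' O' : Finset (Fin (m + 1))) (jt jl js : Fin (m + 1)) (i : Fin n)
    (hpair : I.IsScarfPair B O) (hiter : I.IsIteration B O B' O')
    (hjt : O \ B = {jt}) (hjl : B \ B' = {jl}) (hjs : O' \ O = {js})
    (hsep : I.IsSeparator B O i) (hnice : I.IsNice i B) (hjs0 : js ≠ 0) :
    (∃ t : Fin m, jt = t.succ ∧ I.f i = ((I.arc t).1, i.castSucc) ∧
      ∃ p, Scarf.IsPath I.f Set.univ (I.arc t).1 p (I.arc t).2 ∧ p.head? = some (i, true)) ∧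
    (∃ l : Fin m, jl = l.succ ∧ I.arc l = I.f i) ∧
    ∃ i' : Fin n, i < i' ∧ I.IsSeparator B' O' i' ∧ I.IsNice i' B' := by
  have hvisits := Scarf.Instance.Visits.step hpair.1 hpair.2 hiter
  have hO := hpair.1.isDominating
  obtain ⟨⟨jt', hjt', htB, x, t, l, p, hx, rfl, hp, hl, rfl⟩, jl', hjl', hpiv⟩ := hiter
  obtain rfl : jt = t.succ := Finset.singleton_injective (hjt.symm.trans hjt')
  obtain ⟨c, hcB, hc⟩ := hnice.exists_arc_eq I le_rfl
  have hec := I.e_eq_of_arc_eq hc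
  have huniq : ∀ j : Fin m, j.succ ∈ B → i ∈ I.e j → j = c := fun j hj hij =>
    I.blockOrder.1 ((I.e_eq_of_arc_eq (hnice.arc_eq_of_mem I le_rfl hj hij)).trans hec.symm)
  obtain ⟨-, d, hd, hblock⟩ := hsep
  obtain rfl : d = t := by
    have hdB : d.succ ∉ B := fun h =>
      hblock.1 (by rw [huniq d h hblock.2.1, hec])
    have : d.succ ∈ O \ B := Finset.mem_sdiff.2 ⟨hd.1, hdB⟩
    rw [hjt] at this
    exact Fin.succ_injective _ (Finset.mem_singleton.1 this)
  have D : I.NicePivot B x i c d p :=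
    ⟨hx, hcB, hc, huniq, hblock.2, hp, htB, hnice.exists_augmenting I hx⟩
  obtain rfl := D.leaving_eq hl
  obtain rfl : jl = l.succ := by
    have : l.succ ∈ B \ insert d.succ (B.erase l.succ) := by
      refine Finset.mem_sdiff.2 ⟨hcB, ?_⟩
      simp only [Finset.mem_insert, Finset.mem_erase, ne_eq, not_true_eq_false, false_and, or_false]
      exact fun h => htB (h ▸ hcB)
    rw [hjl] at this
    exact (Finset.mem_singleton.1 this).symm
  have hOB : ∀ j ∈ O, j ∈ B ∨ j = d.succ := by
    intro j hj
    by_cases hjB : j ∈ B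
    · exact Or.inl hjB
    · have : j ∈ O \ B := Finset.mem_sdiff.2 ⟨hj, hjB⟩
      rw [hjt] at this
      exact Or.inr (Finset.mem_singleton.1 this)
  obtain rfl : jl' = l.succ := by
    have : jl' ∈ O \ insert d.succ (B.erase l.succ) := by simp [hjl']
    rw [Finset.mem_sdiff, Finset.mem_insert, Finset.mem_erase] at this
    have := hOB jl' this.1
    tauto
  obtain ⟨s, rfl⟩ := Fin.exists_succ_eq.2 hjs0
  have hsO : s.succ ∈ O' ∧ s.succ ∉ O := Finset.mem_sdiff.1 (by simp [hjs])
  -- By equal cardinalities `B \ O` has a single element, namely column 0. Since neither `B` nor `t`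
  -- supplies the entering column, the new pair is not yet terminal.
  have hsB : s.succ ∉ B := by
    have hcard : (B \ O).card = 1 := by
      rw [Finset.card_sdiff_comm (((I.isCardinalBasis_iff).1 hx.1).1.trans hO.1.symm), hjt,
        Finset.card_singleton]
    obtain ⟨a, ha⟩ := Finset.card_eq_one.1 hcard
    have h0 : 0 ∈ B \ O := Finset.mem_sdiff.2 ⟨Scarf.Instance.zero_mem_of_isVertex hx,
      Scarf.Instance.zero_notMem_of_isDisliked hd⟩
    intro hsB
    have h1 : s.succ ∈ B \ O := Finset.mem_sdiff.2 ⟨hsB, hsO.2⟩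
    rw [ha, Finset.mem_singleton] at h0 h1
    exact hjs0 (h1.trans h0.symm)
  obtain ⟨i', hi, hi', hdis⟩ := Scarf.Instance.exists_separator_of_isOrdinalPivot hO hpiv hjs hec hd
    hblock fun a ha hia => (hOB a.succ ha).imp (fun h => huniq a h hia) (Fin.succ_injective _ ·)
  refine ⟨⟨d, rfl, ?_, I.exists_isPath_head hblock.2⟩, ⟨l, rfl, hc⟩, i', hi,
    ⟨⟨hvisits, fun h => ?_⟩, s, hdis, hi'⟩, D.isNice hnice hi⟩
  · rw [I.arc_fst_eq hblock.2, ← I.depthFirst.2.2 i]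
  · have h1 := hsO.1
    rw [← h, Finset.mem_insert, Finset.mem_erase] at h1
    rcases h1 with h1 | h1
    · exact hsO.2 (h1 ▸ hd.1)
    · exact hsB h1.2
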